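/- Let $B,N_t,N_r,L\ge 1$ be integers and let $\mathcal X\subset\mathbb C$ be a constellation of size $2^M$ with unit average energy. In round $\ell$ of an INR-ARQ transmission, block $b=1,\dots,B$ is affected by an $N_r\times N_t$ fading matrix $H_{\ell,b}$; all entries of all these matrices are independent $\mathcal N_{\mathbb C}(0,1)$. For an $N_r\times N_t$ matrix $G$, let $I_{\mathcal X}(G)$ be the mutual information in bits between $x$ and $Gx+w$, where $x$ is uniform on $\mathcal X^{N_t}$ and $w$ has independent $\mathcal N_{\mathbb C}(0,1)$ entries and is independent of $x$. If round $\ell$ uses power $P_\ell$, put $I_\ell=\frac1B\sum_{b=1}^B I_{\mathcal X}\big(\sqrt{P_\ell/N_t}\,H_{\ell,b}\big)$ and $\bar I_\ell=I_1+\dots+I_\ell$. Let $0<R<MN_t$. In an ARQ system with $K$ feedback levels, the index $k_\ell=K-1$ (acknowledgment) is fed back after round $\ell$ if $\bar I_\ell\ge R$; otherwise the fed-back index is the $k_\ell\in\{0,\dots,K-2\}$ with $\theta([\mathbf k_{\ell-1},k_\ell])\le\bar I_\ell<\theta([\mathbf k_{\ell-1},k_\ell+1])$. Here $\mathbf k_{\ell-1}=[k_1,\dots,k_{\ell-1}]$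 and $\theta$ gives real quantization thresholds, which may depend on all previous feedback and satisfy $\theta([0])=0$ (for the first round), $\theta([\mathbf k,0])=\theta(\mathbf k)$ and $\theta([\mathbf k,0])<\dots<\theta([\mathbf k,K-2])$, with $\theta([\mathbf k,K-1])$ read as $\infty$. The power of round $\ell$ is a function $P_\ell(\mathbf k_{\ell-1})\ge0$ of the previous feedback and is $0$ after an acknowledgment. The system satisfies the long-term power constraint $P$ if $$\sum_{\ell=1}^{L}\ \sum_{\mathbf k\in\{0,\dots,K-1\}^{\ell-1}}\Pr(\mathbf k_{\ell-1}=\mathbf k)\,P_\ell(\mathbf k)\le P.$$ Its outage probability at round $\ell$ is $p(\ell)=\Pr(\bar I_\ell<R)$. Assume that $BR/M$ is not an integer and that $K\ge\lceil BR/M\rceil+1$. Put $$d^\dagger(R)=N_r\Big(1+\Big\lfloor B\Big(N_t-\frac RM\Big)\Big\rfloor\Big),\qquad d_\ell(R)=(1+BN_tN_r)^{\ell-1}\big(d^\dagger(R)+1\big)-1 .$$ Then $d_\ell(R)$ is the optimal outage diversity at every round $\ell=1,\dots,L$: if $p^*_\ell(P)$ denotes the infimum of $p(\ell)$ over all such systems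 (all thresholds and power rules) that satisfy the power constraint $P$, then $$\lim_{P\to\infty}\frac{-\log p^*_\ell(P)}{\log P}=d_\ell(R).$$ Moreover, there are thresholds, not depending on $P$, and for each $P>0$ a power rule satisfying the constraint $P$, such that the outage probabilities of the resulting systems satisfy $\lim_{P\to\infty}\frac{-\log p(\ell)}{\log P}=d_\ell(R)$ simultaneously for all $\ell=1,\dots,L$. -/

import Mathlib

open MeasureTheory ProbabilityTheory Filter Topology

noncomputable section

namespace INRARQ

/-! ## Mutual information of a MIMO channel with a discrete constellation -/

/-- Density at `y` of the output `G x + w` of the MIMO channel with gain matrix `G`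
and input vector `x`, the entries of `w` being independent `𝒩_ℂ(0,1)` variables. -/
def outputDensity {Nr Nt : ℕ} (G : Matrix (Fin Nr) (Fin Nt) ℂ) (x : Fin Nt → ℂ)
    (y : Fin Nr → ℂ) : ℝ :=
  (Real.pi ^ Nr)⁻¹ * Real.exp (-∑ r, ‖y r - G.mulVec x r‖ ^ 2)

/-- Density of the channel output when the input is uniformly distributed on `𝒳^Nt`. -/
def outputMarginal (𝒳 : Finset ℂ) {Nr Nt : ℕ} (G : Matrix (Fin Nr) (Fin Nt) ℂ)
    (y : Fin Nr → ℂ) : ℝ :=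
  ((𝒳.card : ℝ) ^ Nt)⁻¹ * ∑ x : Fin Nt → 𝒳, outputDensity G (fun t => (x t : ℂ)) y

/-- Input-output mutual information, in bits per channel use, of the channel
`y = G x + w` with input uniformly distributed on `𝒳^Nt`. -/
def mutualInfo (𝒳 : Finset ℂ) {Nr Nt : ℕ} (G : Matrix (Fin Nr) (Fin Nt) ℂ) : ℝ :=
  ((𝒳.card : ℝ) ^ Nt)⁻¹ * ∑ x : Fin Nt → 𝒳, ∫ y : Fin Nr → ℂ,
    outputDensity G (fun t => (x t : ℂ)) y *
      Real.logb 2 (outputDensity G (fun t => (x t : ℂ)) y / outputMarginal 𝒳 G y)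

/-! ## Block fading -/

/-- The circularly symmetric complex Gaussian law `𝒩_ℂ(0,1)`. -/
def stdComplexGaussian : Measure ℂ :=
  ((gaussianReal 0 (1 / 2)).prod (gaussianReal 0 (1 / 2))).map
    Complex.measurableEquivRealProd.symm

instance : IsProbabilityMeasure stdComplexGaussian :=
  Measure.isProbabilityMeasure_map Complex.measurableEquivRealProd.symm.measurable.aemeasurable

/-- The fading gains of one ARQ round: one `Nr × Nt` matrix for each of the `B` blocks. -/
abbrev RoundGain (B Nr Nt : ℕ) : Type := Fin B → Fin Nr → Fin Nt → ℂ

/-- All the gains of one round are independent `𝒩_ℂ(0,1)` variables. -/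
def roundLaw (B Nr Nt : ℕ) : Measure (RoundGain B Nr Nt) :=
  Measure.pi fun _ => Measure.pi fun _ => Measure.pi fun _ => stdComplexGaussian

instance (B Nr Nt : ℕ) : IsProbabilityMeasure (roundLaw B Nr Nt) := by
  unfold roundLaw; infer_instance

/-- Joint law of the fading gains: rounds `0, 1, 2, …` are independent. -/
def fadingLaw (B Nr Nt : ℕ) : Measure (ℕ → RoundGain B Nr Nt) :=
  Measure.infinitePi fun _ => roundLaw B Nr Nt

/-- Mutual information of one round used with transmit power `p`:
the average over the `B` blocks. -/
def roundInfo (𝒳 : Finset ℂ) {B Nr Nt : ℕ} (p : ℝ) (h : RoundGain B Nr Nt) : ℝ :=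
  (B : ℝ)⁻¹ * ∑ b, mutualInfo 𝒳 (((Real.sqrt (p / Nt) : ℝ) : ℂ) • Matrix.of (h b))

/-! ## Multi-level feedback and power adaptation

Feedback indices are elements of `Fin K`; a feedback vector collected over `n` rounds is
a function `Fin n → Fin K`, extended by one index with `Fin.snoc`. -/

/-- The index `K - 1`, which means positive acknowledgment. -/
def ack (K : ℕ) [NeZero K] : Fin K := ⟨K - 1, Nat.sub_lt (NeZero.pos K) one_pos⟩

/-- Quantization thresholds: `thr n fb k` is the threshold `Ī([fb, k])` used in the round
that follows the feedback vector `fb` of length `n`. Only the values at `k ≤ K - 2` matter. -/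
structure Quantizer (K : ℕ) where
  thr : (n : ℕ) → (Fin n → Fin K) → ℕ → ℝ
  thr_first : ∀ fb : Fin 0 → Fin K, thr 0 fb 0 = 0
  thr_snoc : ∀ (n : ℕ) (fb : Fin n → Fin K) (k : Fin K), (k : ℕ) + 1 < K →
    thr (n + 1) (Fin.snoc (α := fun _ => Fin K) fb k) 0 = thr n fb k
  thr_lt : ∀ (n : ℕ) (fb : Fin n → Fin K) (k : ℕ), k + 2 < K → thr n fb k < thr n fb (k + 1)

/-- A power adaptation rule: `power n fb` is the power of the round that follows the feedback
vector `fb` of length `n`. Nothing is transmitted after a positive acknowledgment. -/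
structure PowerRule (K : ℕ) [NeZero K] where
  power : (n : ℕ) → (Fin n → Fin K) → ℝ
  power_nonneg : ∀ n fb, 0 ≤ power n fb
  power_ack : ∀ (n : ℕ) (fb : Fin n → Fin K), (∃ i, fb i = ack K) → power n fb = 0

open Classical in
/-- The index fed back when the previous indices are `fb` and the accumulated mutual
information is `a`: the acknowledgment if `R ≤ a`; otherwise the index `k ≤ K - 2` with
`thr k ≤ a < thr (k + 1)`, where the threshold number `K - 1` counts as `∞`. -/
def feedbackIndex {K : ℕ} [NeZero K] (Q : Quantizer K) (R : ℝ) {n : ℕ} (fb : Fin n → Fin K)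
    (a : ℝ) : Fin K :=
  if R ≤ a then ack K
  else ⟨Nat.findGreatest (fun k => Q.thr n fb k ≤ a) (K - 2),
    lt_of_le_of_lt (Nat.findGreatest_le _)
      (Nat.sub_lt (NeZero.pos K) two_pos)⟩

section System

variable (𝒳 : Finset ℂ) {B Nr Nt K : ℕ} [NeZero K] (R : ℝ) (Q : Quantizer K) (S : PowerRule K)

/-- Feedback vector and accumulated mutual information after `n` rounds, for the fading
realization `h`. -/
def state (h : ℕ → RoundGain B Nr Nt) : (n : ℕ) → (Fin n → Fin K) × ℝ
  | 0 => (Fin.elim0, 0)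
  | n + 1 =>
    let fb := (state h n).1
    let a := (state h n).2 + roundInfo 𝒳 (S.power n fb) (h n)
    (Fin.snoc (α := fun _ => Fin K) fb (feedbackIndex Q R fb a), a)

/-- The feedback vector `[k_1, …, k_n]` after `n` rounds. -/
def feedback (h : ℕ → RoundGain B Nr Nt) (n : ℕ) : Fin n → Fin K := (state 𝒳 R Q S h n).1

/-- The mutual information accumulated over the first `n` rounds. -/
def accInfo (h : ℕ → RoundGain B Nr Nt) (n : ℕ) : ℝ := (state 𝒳 R Q S h n).2

variable (B Nr Nt)

/-- The probability `q(fb)` of the feedback vector `fb`. -/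
def feedbackProb {n : ℕ} (fb : Fin n → Fin K) : ℝ :=
  (fadingLaw B Nr Nt).real {h | feedback 𝒳 R Q S h n = fb}

/-- Average power spent on a codeword in at most `L` rounds. -/
def averagePower (L : ℕ) : ℝ :=
  ∑ n ∈ Finset.range L, ∑ fb : Fin n → Fin K, feedbackProb 𝒳 B Nr Nt R Q S fb * S.power n fb

/-- The outage probability `p(ℓ)` at round `ℓ`. -/
def outageProb (l : ℕ) : ℝ :=
  (fadingLaw B Nr Nt).real {h | accInfo 𝒳 R Q S h l < R}

end System

/-- The smallest outage probability at round `l` over all systems with `K` feedback levels and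
at most `L` rounds whose average power does not exceed `P`. -/
def optimalOutageProb (𝒳 : Finset ℂ) (B Nr Nt K : ℕ) [NeZero K] (R : ℝ) (L l : ℕ) (P : ℝ) : ℝ :=
  sInf {p : ℝ | ∃ (Q : Quantizer K) (S : PowerRule K),
    averagePower 𝒳 B Nr Nt R Q S L ≤ P ∧ p = outageProb 𝒳 B Nr Nt R Q S l}

/-- The Singleton-bound exponent `d†(R) = Nr (1 + ⌊B (Nt - R / M)⌋)`. -/
def singletonDiversity (B Nr Nt : ℕ) (M R : ℝ) : ℝ :=
  Nr * (1 + (⌊(B : ℝ) * (Nt - R / M)⌋ : ℝ))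

/-- `(1 + B Nt Nr)^(l - 1) (d†(R) + 1) - 1`, for rounds `l ≥ 1`. -/
def arqDiversity (B Nr Nt : ℕ) (M R : ℝ) (l : ℕ) : ℝ :=
  (1 + (B : ℝ) * Nt * Nr) ^ (l - 1) * (singletonDiversity B Nr Nt M R + 1) - 1

end INRARQ

end

noncomputable section

namespace INRARQ

/-! ## Gaussian densities on `ℂⁿ` -/

/-! Write `N = B * Nt`, `u = M / B` and `J = ⌊B R / M⌋`, so that `J u < R < (J + 1) u`. A round
behaves as if it delivered an integer number of symbols, each worth `u`, and the proof rests on the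
price of losing some of them.

One round. By `exists_le_mutualInfo`, a channel loses only the dimension of the span of the codeword
differences that it nearly annihilates, up to an arbitrarily small error. Annihilating `k`
independent differences forces all `Nr` rows into a small neighbourhood of a subspace of codimension
`k`, which has probability of order `p ^ (-Nr k)` at power `p`. Conversely, small columns do lose
their symbols (`exists_mutualInfo_le`). Hence `exists_roundLaw_roundInfo_lt_le` and
`exists_le_roundLaw_roundInfo_le`: losing `D` symbols costs `p ^ (-Nr D)`, up to constants, in both
directions.

Converse (`exists_le_outageProb`). If a feedback vector occurs jointly with almost no information
with probability `r`, the power constraint caps the next power at `P / r`. All symbols of the next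
round are then lost with probability at least of order `(P / r) ^ (-Nr N)`, and one of the `K`
continuations keeps a fixed share of this. So `P / r` is raised at most to the power `1 + Nr N` in
each round, up to constants. In the last round it is enough to lose `N - J` symbols.

Achievability (`activeEvent_mul_pow_le`, `outageProb_grid_le`). Thresholds slightly below the
multiples of `u` let the feedback count the symbols received. The power after each feedback vector
is about the inverse of the probability bound for that vector, times `x`, so every vector consumes
average power `O(x)`. An outage may distribute its at most `J` symbols over the rounds in many ways;
`pow_mul_le_fbExp_mul` shows that all of them have at least the exponent of the path that receives
nothing before the last round, which is the path used in the converse. -/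

/-- Squared Euclidean distance on `ℂⁿ`. -/
def sqDist {n : ℕ} (a b : Fin n → ℂ) : ℝ := ∑ r, ‖a r - b r‖ ^ 2

/-- Density of the standard complex Gaussian vector centred at `a`. -/
def gaussDens {n : ℕ} (a y : Fin n → ℂ) : ℝ := (Real.pi ^ n)⁻¹ * Real.exp (-sqDist y a)

lemma gaussDens_pos {n : ℕ} (a y : Fin n → ℂ) : 0 < gaussDens a y := by
  unfold gaussDens; positivity

lemma continuous_gaussDens {n : ℕ} (a : Fin n → ℂ) : Continuous (gaussDens a) := by
  unfold gaussDens sqDist; fun_prop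

lemma integral_gaussDens {n : ℕ} (a : Fin n → ℂ) : ∫ y, gaussDens a y = 1 := by
  have h1 : ∀ z : ℂ, ∫ y : ℂ, Real.pi⁻¹ * Real.exp (-‖y - z‖ ^ 2) = 1 := by
    intro z
    rw [integral_const_mul, integral_sub_right_eq_self (fun y : ℂ => Real.exp (-‖y‖ ^ 2)) z]
    have := GaussianFourier.integral_rexp_neg_mul_sq_norm (V := ℂ) (b := 1) one_pos
    simp only [neg_mul, one_mul, Complex.finrank_real_complex] at this
    rw [this]
    norm_num
  have h2 : ∀ y, gaussDens a y = ∏ r, (Real.pi⁻¹ * Real.exp (-‖y r - a r‖ ^ 2)) := by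
    intro y
    rw [Finset.prod_mul_distrib, ← Real.exp_sum]
    simp [gaussDens, sqDist]
  simp_rw [h2]
  rw [integral_fintype_prod_volume_eq_prod (fun r (z : ℂ) => Real.pi⁻¹ * Real.exp (-‖z - a r‖ ^ 2))]
  simp [h1]

lemma integrable_gaussDens {n : ℕ} (a : Fin n → ℂ) : Integrable (gaussDens a) :=
  integrable_of_integral_eq_one (integral_gaussDens a)

/-- Completing the square: the geometric mean of two Gaussian densities is a multiple of the
Gaussian at the midpoint. The factor is the Bhattacharyya coefficient, which makes distant
components negligible. -/
lemma gaussDens_mul_sqrt_div {n : ℕ} (a b y : Fin n → ℂ) :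
    gaussDens a y * √(gaussDens b y / gaussDens a y) =
      Real.exp (-sqDist a b / 4) * gaussDens (fun r => (a r + b r) / 2) y := by
  have h : gaussDens b y / gaussDens a y = Real.exp (sqDist y a - sqDist y b) := by
    unfold gaussDens
    rw [mul_div_mul_left _ _ (by positivity), ← Real.exp_sub]
    ring_nf
  rw [h, ← Real.exp_half]
  unfold gaussDens
  rw [mul_assoc, ← Real.exp_add, mul_left_comm, ← Real.exp_add]
  congr 2
  simp only [sqDist, ← Finset.sum_neg_distrib, ← Finset.sum_sub_distrib, Finset.sum_div,
    ← Finset.sum_add_distrib]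
  refine Finset.sum_congr rfl fun r _ => ?_
  simp only [Complex.sq_norm, Complex.normSq_apply, Complex.sub_re, Complex.sub_im,
    Complex.add_re, Complex.add_im, Complex.div_ofNat_re, Complex.div_ofNat_im]
  ring

/-- The same completion of the square with exponents `3/2` and `-1/2`; the factor is close to `1`
when the two centres are close. -/
lemma gaussDens_mul_sqrt_div' {n : ℕ} (a b y : Fin n → ℂ) :
    gaussDens a y * √(gaussDens a y / gaussDens b y) =
      Real.exp (3 / 4 * sqDist a b) * gaussDens (fun r => (3 * a r - b r) / 2) y := by
  have h : gaussDens a y / gaussDens b y = Real.exp (sqDist y b - sqDist y a) := by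
    unfold gaussDens
    rw [mul_div_mul_left _ _ (by positivity), ← Real.exp_sub]
    ring_nf
  rw [h, ← Real.exp_half]
  unfold gaussDens
  rw [mul_assoc, ← Real.exp_add, mul_left_comm, ← Real.exp_add]
  congr 2
  simp only [sqDist, ← Finset.sum_neg_distrib, ← Finset.sum_sub_distrib, Finset.sum_div,
    ← Finset.sum_add_distrib, Finset.mul_sum]
  refine Finset.sum_congr rfl fun r _ => ?_
  simp only [Complex.sq_norm, Complex.normSq_apply, Complex.sub_re, Complex.sub_im,
    Complex.div_ofNat_re, Complex.div_ofNat_im, Complex.mul_re,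
    Complex.mul_im, Complex.re_ofNat, Complex.im_ofNat]
  ring

/-! ## Equivocation of a finite Gaussian mixture -/

section Equivocation

variable {ι : Type*} [Fintype ι] {n : ℕ} (a : ι → Fin n → ℂ)

/-- Sum of the densities of all components. -/
def totalDens (y : Fin n → ℂ) : ℝ := ∑ i, gaussDens (a i) y

/-- The unnormalized conditional entropy (in nats) contributed by component `i`. -/
def compEquiv (i : ι) : ℝ :=
  ∫ y, gaussDens (a i) y * Real.log (totalDens a y / gaussDens (a i) y)

lemma gaussDens_le_totalDens (i : ι) (y : Fin n → ℂ) : gaussDens (a i) y ≤ totalDens a y :=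
  Finset.single_le_sum (f := fun i => gaussDens (a i) y) (fun _ _ => (gaussDens_pos _ _).le)
    (Finset.mem_univ i)

lemma log_ratio_nonneg (i : ι) (y : Fin n → ℂ) :
    0 ≤ Real.log (totalDens a y / gaussDens (a i) y) :=
  Real.log_nonneg ((one_le_div (gaussDens_pos _ _)).2 (gaussDens_le_totalDens a i y))

lemma log_one_add_le_sqrt {u : ℝ} (hu : 0 ≤ u) : Real.log (1 + u) ≤ √u := by
  rw [Real.log_le_iff_le_exp (by linarith)]
  -- With `s = √u`, the claim `1 + s ^ 2 ≤ exp s` already holds for the Taylor polynomial of degree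
  -- four.
  have h4 := Real.sum_le_exp_of_nonneg (Real.sqrt_nonneg u) 5
  have h2 : √u ^ 2 = u := Real.sq_sqrt hu
  simp only [Finset.sum_range_succ, Finset.sum_range_zero, Nat.factorial] at h4
  norm_num at h4
  set s := √u
  have hs : 0 ≤ s := Real.sqrt_nonneg u
  rw [← h2]
  nlinarith [sq_nonneg (s - 2), mul_nonneg hs (sq_nonneg (s - 2)), sq_nonneg (s * (s - 2)),
    sq_nonneg (s ^ 2 - 2 * s), mul_nonneg hs (sq_nonneg (s - 1))]

lemma sqrt_sum_le {κ : Type*} (s : Finset κ) (u : κ → ℝ) (hu : ∀ j, 0 ≤ u j) :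
    √(∑ j ∈ s, u j) ≤ ∑ j ∈ s, √(u j) := by
  have hnn : 0 ≤ ∑ j ∈ s, √(u j) := Finset.sum_nonneg fun _ _ => Real.sqrt_nonneg _
  rw [Real.sqrt_le_left hnn]
  calc ∑ j ∈ s, u j = ∑ j ∈ s, √(u j) ^ 2 :=
        Finset.sum_congr rfl fun j _ => (Real.sq_sqrt (hu j)).symm
    _ ≤ (∑ j ∈ s, √(u j)) ^ 2 :=
        Finset.sum_sq_le_sq_sum_of_nonneg fun _ _ => Real.sqrt_nonneg _

lemma log_div_split {m f c u : ℝ} (hm : 0 < m) (hf : 0 < f) (hc : 0 < c) (hu : 0 ≤ u) :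
    Real.log ((c + u) / f) = Real.log m + Real.log (c / (m * f)) + Real.log (1 + u / c) := by
  have h1 : 0 < c / (m * f) := by positivity
  have h2 : 0 < 1 + u / c := by positivity
  rw [← Real.log_mul hm.ne' h1.ne', ← Real.log_mul (mul_pos hm h1).ne' h2.ne']
  congr 1
  field_simp

/-! ### Upper bound on the equivocation by clustering the components -/

section Clusters

variable {κ : Type*} [DecidableEq κ] (cl : ι → κ) (m : ℝ)

/-- Pointwise majorant of the equivocation integrand for a partition into clusters. -/
def clusterMajorant (i : ι) (y : Fin n → ℂ) : ℝ :=
  gaussDens (a i) y * Real.log m +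
    ((∑ j with cl j = cl i, gaussDens (a j) y) / m - gaussDens (a i) y) +
    ∑ j with cl j ≠ cl i, gaussDens (a i) y * √(gaussDens (a j) y / gaussDens (a i) y)

/-- The logarithm splits into the cluster size, the ratio of the cluster density to `m` times the
component, and the interference of other clusters. The last two are bounded by `log t ≤ t - 1` and
`log (1 + t) ≤ √t`, which leaves only terms with explicit Gaussian integrals. -/
lemma le_clusterMajorant (hm : 0 < m) (i : ι) (y : Fin n → ℂ) :
    gaussDens (a i) y * Real.log (totalDens a y / gaussDens (a i) y) ≤
      clusterMajorant a cl m i y := by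
  have hf0 : 0 < gaussDens (a i) y := gaussDens_pos _ _
  have hsplit : totalDens a y = ∑ j with cl j = cl i, gaussDens (a j) y +
      ∑ j with cl j ≠ cl i, gaussDens (a j) y :=
    (Finset.sum_filter_add_sum_filter_not _ _ _).symm
  have hle : gaussDens (a i) y ≤ ∑ j with cl j = cl i, gaussDens (a j) y :=
    Finset.single_le_sum (f := fun j => gaussDens (a j) y)
      (fun _ _ => (gaussDens_pos _ _).le) (by simp)
  have hFf0 : 0 ≤ ∑ j with cl j ≠ cl i, gaussDens (a j) y :=
    Finset.sum_nonneg fun _ _ => (gaussDens_pos _ _).le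
  have hsq : √((∑ j with cl j ≠ cl i, gaussDens (a j) y) / gaussDens (a i) y) ≤
      ∑ j with cl j ≠ cl i, √(gaussDens (a j) y / gaussDens (a i) y) := by
    rw [Finset.sum_div]
    exact sqrt_sum_le _ _ fun j => (div_pos (gaussDens_pos _ _) hf0).le
  unfold clusterMajorant
  rw [← Finset.mul_sum, hsplit]
  generalize (∑ j with cl j = cl i, gaussDens (a j) y) = Fc at *
  generalize (∑ j with cl j ≠ cl i, gaussDens (a j) y) = Ff at *
  generalize (∑ j with cl j ≠ cl i, √(gaussDens (a j) y / gaussDens (a i) y)) = S at *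
  generalize gaussDens (a i) y = f at *
  have hFc0 : 0 < Fc := hf0.trans_le hle
  have h1 : Real.log (Fc / (m * f)) ≤ Fc / (m * f) - 1 :=
    Real.log_le_sub_one_of_pos (by positivity)
  have h2 : Real.log (1 + Ff / Fc) ≤ S := by
    refine le_trans ?_ hsq
    refine le_trans ?_ (log_one_add_le_sqrt (by positivity))
    apply Real.log_le_log (by positivity)
    gcongr
  have h3 : f * (Fc / (m * f) - 1) = Fc / m - f := by field_simp
  rw [log_div_split hm hf0 hFc0 hFf0, ← h3, ← mul_add, ← mul_add]
  gcongr

lemma integrable_clusterMajorant (i : ι) : Integrable (clusterMajorant a cl m i) := by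
  unfold clusterMajorant
  simp_rw [gaussDens_mul_sqrt_div]
  refine ((integrable_gaussDens _).mul_const _ |>.add
    (((integrable_finsetSum _ fun j _ => integrable_gaussDens _).div_const _).sub
      (integrable_gaussDens _))).add
    (integrable_finsetSum _ fun j _ => (integrable_gaussDens _).const_mul _)

lemma integral_clusterMajorant (i : ι) : ∫ y, clusterMajorant a cl m i y =
    Real.log m + ((Finset.univ.filter fun j => cl j = cl i).card / m - 1) +
      ∑ j with cl j ≠ cl i, Real.exp (-sqDist (a i) (a j) / 4) := by
  unfold clusterMajorant
  simp_rw [gaussDens_mul_sqrt_div]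
  rw [integral_add, integral_add, integral_sub, integral_mul_const, integral_div,
    integral_finsetSum, integral_finsetSum]
  · simp_rw [integral_const_mul, integral_gaussDens]
    simp
  · exact fun j _ => (integrable_gaussDens _).const_mul _
  · exact fun j _ => integrable_gaussDens _
  · exact (integrable_finsetSum _ fun j _ => integrable_gaussDens _).div_const _
  · exact integrable_gaussDens _
  · exact (integrable_gaussDens _).mul_const _
  · exact ((integrable_finsetSum _ fun j _ => integrable_gaussDens _).div_const _).sub
      (integrable_gaussDens _)
  · exact (integrable_gaussDens _).mul_const _ |>.add
      (((integrable_finsetSum _ fun j _ => integrable_gaussDens _).div_const _).sub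
      (integrable_gaussDens _))
  · exact integrable_finsetSum _ fun j _ => (integrable_gaussDens _).const_mul _

end Clusters

lemma measurable_totalDens : Measurable (totalDens a) := by
  unfold totalDens
  exact Finset.measurable_sum _ fun i _ => (continuous_gaussDens _).measurable

lemma integrable_compEquiv (i : ι) :
    Integrable fun y => gaussDens (a i) y * Real.log (totalDens a y / gaussDens (a i) y) := by
  -- A single cluster containing everything gives an integrable majorant.
  refine (integrable_clusterMajorant a (fun _ => ()) 1 i).mono' ?_ (ae_of_all _ fun y => ?_)
  · exact ((continuous_gaussDens _).measurable.mul
      ((measurable_totalDens a).div (continuous_gaussDens _).measurable).log).aestronglyMeasurable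
  · rw [Real.norm_of_nonneg (mul_nonneg (gaussDens_pos _ _).le (log_ratio_nonneg a i y))]
    exact le_clusterMajorant a _ 1 one_pos i y

/-- Components in different clusters are at squared distance at least `A`, and a cluster has at
most `m` components: the equivocation is essentially at most `log m`. -/
lemma compEquiv_le {κ : Type*} (cl : ι → κ) {m A : ℝ} (hm : 0 < m) (i : ι)
    (hcard : ({j | cl j = cl i} : Set ι).ncard ≤ m)
    (hfar : ∀ j, cl j ≠ cl i → A ≤ sqDist (a i) (a j)) :
    compEquiv a i ≤ Real.log m + Fintype.card ι * Real.exp (-A / 4) := by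
  classical
  have hcard' : (((Finset.univ.filter fun j => cl j = cl i).card : ℕ) : ℝ) ≤ m := by
    rw [← Set.ncard_coe_finset]
    simpa using hcard
  have h := integral_mono (integrable_compEquiv a i) (integrable_clusterMajorant a cl m i)
    (le_clusterMajorant a cl m hm i)
  rw [integral_clusterMajorant] at h
  have h1 : ((Finset.univ.filter fun j => cl j = cl i).card : ℝ) / m ≤ 1 :=
    (div_le_one hm).2 hcard'
  have h2 : ∑ j with cl j ≠ cl i, Real.exp (-sqDist (a i) (a j) / 4) ≤
      Fintype.card ι * Real.exp (-A / 4) := by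
    calc ∑ j with cl j ≠ cl i, Real.exp (-sqDist (a i) (a j) / 4)
        ≤ ∑ j with cl j ≠ cl i, Real.exp (-A / 4) := by
          refine Finset.sum_le_sum fun j hj => Real.exp_le_exp.2 ?_
          have := hfar j (by simpa using hj)
          linarith
      _ ≤ ∑ j : ι, Real.exp (-A / 4) :=
          Finset.sum_le_univ_sum_of_nonneg fun _ => (Real.exp_pos _).le
      _ = _ := by simp
  unfold compEquiv
  linarith

/-- If `m` components are close to component `i`, then its equivocation is essentially at least
`log m`. -/
lemma le_compEquiv (i : ι) (s : Finset ι) (hs : s.Nonempty) {ε : ℝ}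
    (hε : ∀ j ∈ s, sqDist (a i) (a j) ≤ ε) :
    Real.log s.card - 2 * (Real.exp (3 / 4 * ε) - 1) ≤ compEquiv a i := by
  have hm : (0 : ℝ) < s.card := by exact_mod_cast hs.card_pos
  set minor : (Fin n → ℂ) → ℝ := fun y => gaussDens (a i) y * Real.log s.card +
    (s.card : ℝ)⁻¹ * ∑ j ∈ s, (2 * gaussDens (a i) y -
      2 * (gaussDens (a i) y * √(gaussDens (a i) y / gaussDens (a j) y))) with hminor
  have hpt : ∀ y, minor y ≤
      gaussDens (a i) y * Real.log (totalDens a y / gaussDens (a i) y) := by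
    intro y
    set f := gaussDens (a i) y with hf
    have hf0 : 0 < f := gaussDens_pos _ _
    have hpos : ∀ j, 0 < gaussDens (a j) y / f := fun j => div_pos (gaussDens_pos _ _) hf0
    -- Jensen's inequality for the uniform average over `s`, after the components outside `s` are
    -- discarded.
    have h1 : Real.log s.card + (s.card : ℝ)⁻¹ * ∑ j ∈ s, Real.log (gaussDens (a j) y / f) ≤
        Real.log (totalDens a y / f) := by
      have hj := strictConcaveOn_log_Ioi.concaveOn.le_map_sum (t := s)
        (w := fun _ => (s.card : ℝ)⁻¹) (p := fun j => gaussDens (a j) y / f)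
        (fun _ _ => by positivity) (by simp [hm.ne']) (fun j _ => hpos j)
      simp only [smul_eq_mul, ← Finset.mul_sum] at hj
      have hsum : 0 < ∑ j ∈ s, gaussDens (a j) y / f := Finset.sum_pos (fun j _ => hpos j) hs
      rw [Real.log_mul (by positivity) hsum.ne', Real.log_inv] at hj
      have hle : ∑ j ∈ s, gaussDens (a j) y / f ≤ totalDens a y / f := by
        rw [← Finset.sum_div]
        gcongr
        exact Finset.sum_le_univ_sum_of_nonneg fun _ => (gaussDens_pos _ _).le
      have := Real.log_le_log hsum hle
      linarith
    -- Applying `log t ≤ t - 1` to the square root of the inverse ratio keeps the minorant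
    -- explicitly integrable.
    have h2 : ∀ j, 2 - 2 * √(f / gaussDens (a j) y) ≤ Real.log (gaussDens (a j) y / f) := by
      intro j
      have hq : 0 < f / gaussDens (a j) y := div_pos hf0 (gaussDens_pos _ _)
      have h := Real.log_le_sub_one_of_pos (Real.sqrt_pos.2 hq)
      rw [Real.log_sqrt hq.le] at h
      have : Real.log (gaussDens (a j) y / f) = -Real.log (f / gaussDens (a j) y) := by
        rw [← Real.log_inv, inv_div]
      linarith
    calc minor y = f * (Real.log s.card +
          (s.card : ℝ)⁻¹ * ∑ j ∈ s, (2 - 2 * √(f / gaussDens (a j) y))) := by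
          simp only [hminor, ← hf]
          have : ∑ j ∈ s, (2 * f - 2 * (f * √(f / gaussDens (a j) y))) =
              f * ∑ j ∈ s, (2 - 2 * √(f / gaussDens (a j) y)) := by
            rw [Finset.mul_sum]
            exact Finset.sum_congr rfl fun j _ => by ring
          rw [this]
          ring
      _ ≤ f * (Real.log s.card + (s.card : ℝ)⁻¹ * ∑ j ∈ s, Real.log (gaussDens (a j) y / f)) := by
          gcongr with j _
          exact h2 j
      _ ≤ _ := by gcongr
  have hint : ∀ j, Integrable fun y => 2 * gaussDens (a i) y -
      2 * (gaussDens (a i) y * √(gaussDens (a i) y / gaussDens (a j) y)) := by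
    intro j
    simp_rw [gaussDens_mul_sqrt_div']
    exact ((integrable_gaussDens _).const_mul _).sub
      (((integrable_gaussDens _).const_mul _).const_mul _)
  have hval : ∀ j, ∫ y, (2 * gaussDens (a i) y -
      2 * (gaussDens (a i) y * √(gaussDens (a i) y / gaussDens (a j) y))) =
      2 - 2 * Real.exp (3 / 4 * sqDist (a i) (a j)) := by
    intro j
    simp_rw [gaussDens_mul_sqrt_div']
    rw [integral_sub ((integrable_gaussDens _).const_mul _)
      (((integrable_gaussDens _).const_mul _).const_mul _)]
    simp_rw [integral_const_mul, integral_gaussDens]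
    simp
  have hmi : Integrable minor := ((integrable_gaussDens _).mul_const _).add
    ((integrable_finsetSum _ fun j _ => hint j).const_mul _)
  have h := integral_mono hmi (integrable_compEquiv a i) hpt
  have hv : ∫ y, minor y = Real.log s.card +
      (s.card : ℝ)⁻¹ * ∑ j ∈ s, (2 - 2 * Real.exp (3 / 4 * sqDist (a i) (a j))) := by
    rw [hminor, integral_add ((integrable_gaussDens _).mul_const _)
      ((integrable_finsetSum _ fun j _ => hint j).const_mul _), integral_mul_const,
      integral_gaussDens, one_mul, integral_const_mul, integral_finsetSum _ fun j _ => hint j]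
    simp_rw [hval]
  rw [hv] at h
  have hlow : (s.card : ℝ)⁻¹ * ∑ j ∈ s, (2 - 2 * Real.exp (3 / 4 * ε)) ≤
      (s.card : ℝ)⁻¹ * ∑ j ∈ s, (2 - 2 * Real.exp (3 / 4 * sqDist (a i) (a j))) := by
    gcongr with j hj
    exact hε j hj
  rw [Finset.sum_const, nsmul_eq_mul, inv_mul_cancel_left₀ hm.ne'] at hlow
  unfold compEquiv
  linarith

end Equivocation

/-! ## Bounds on the mutual information -/

/-- A coset of a subspace of dimension `r` meets `𝒳ⁿ` in at most `|𝒳|^r` points. -/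
lemma ncard_coset_le {n : ℕ} (𝒳 : Finset ℂ) (W : Submodule ℂ (Fin n → ℂ)) (x₀ : Fin n → ℂ)
    (h0 : 0 < 𝒳.card) :
    ({x : Fin n → 𝒳 | (fun t => (x t : ℂ)) - x₀ ∈ W} : Set (Fin n → 𝒳)).ncard ≤
      𝒳.card ^ Module.finrank ℂ W := by
  let φ : Fin n → Module.Dual ℂ W := fun t => (LinearMap.proj t).comp W.subtype
  -- A maximal independent family of coordinate functionals on `W` has at most `dim W` members and
  -- spans the others, so its coordinates determine a point of the coset.
  obtain ⟨κ, b, hb, hspan, hli⟩ := exists_linearIndependent' ℂ φ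
  have : Finite κ := Finite.of_injective b hb
  have : Fintype κ := Fintype.ofFinite κ
  have hcard : Fintype.card κ ≤ Module.finrank ℂ W := by
    have := hli.fintype_card_le_finrank
    rwa [Subspace.dual_finrank_eq] at this
  have hinj : Set.InjOn (fun (x : Fin n → 𝒳) (k : κ) => x (b k))
      {x : Fin n → 𝒳 | (fun t => (x t : ℂ)) - x₀ ∈ W} := by
    intro x hx x' hx' hxx
    have hw : (fun t => (x t : ℂ)) - (fun t => (x' t : ℂ)) ∈ W := by
      have := W.sub_mem hx hx'
      simpa using this
    have hker : Submodule.span ℂ (Set.range (φ ∘ b)) ≤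
        LinearMap.ker (LinearMap.applyₗ (R := ℂ) (M₂ := ℂ) (⟨_, hw⟩ : W)) := by
      rw [Submodule.span_le]
      rintro _ ⟨k, rfl⟩
      have := congrFun hxx k
      simp only at this
      simp [φ, this]
    rw [hspan] at hker
    funext t
    have h := hker (Submodule.subset_span ⟨t, rfl⟩)
    simp [φ, sub_eq_zero] at h
    exact h
  calc _ ≤ (Set.univ : Set (κ → 𝒳)).ncard :=
        Set.ncard_le_ncard_of_injOn _ (fun _ _ => Set.mem_univ _) hinj
    _ = 𝒳.card ^ Fintype.card κ := by
        rw [Set.ncard_univ, Nat.card_fun]; simp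
    _ ≤ _ := Nat.pow_le_pow_right h0 hcard

section MutualInfo

variable (𝒳 : Finset ℂ) {Nr Nt : ℕ} (G : Matrix (Fin Nr) (Fin Nt) ℂ)

/-- The noiseless channel output of a codeword. -/
def codePoint (x : Fin Nt → 𝒳) : Fin Nr → ℂ := G.mulVec fun t => (x t : ℂ)

-- Entropy of the input minus its conditional entropy given the output. This reduces bounds on the
-- information to bounds on the equivocation of each codeword.
variable {𝒳} in
lemma mutualInfo_eq (h0 : 0 < 𝒳.card) : mutualInfo 𝒳 G =
    (Real.log ((𝒳.card : ℝ) ^ Nt) - ((𝒳.card : ℝ) ^ Nt)⁻¹ *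
      ∑ x : Fin Nt → 𝒳, compEquiv (codePoint 𝒳 G) x) / Real.log 2 := by
  have hc : (0 : ℝ) < (𝒳.card : ℝ) ^ Nt := by positivity
  have key : ∀ x : Fin Nt → 𝒳, ∫ y : Fin Nr → ℂ,
      outputDensity G (fun t => (x t : ℂ)) y *
      Real.logb 2 (outputDensity G (fun t => (x t : ℂ)) y / outputMarginal 𝒳 G y) =
      (Real.log ((𝒳.card : ℝ) ^ Nt) - compEquiv (codePoint 𝒳 G) x) / Real.log 2 := by
    intro x
    have hpt : ∀ y, outputDensity G (fun t => (x t : ℂ)) y *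
        Real.logb 2 (outputDensity G (fun t => (x t : ℂ)) y / outputMarginal 𝒳 G y) =
        (gaussDens (codePoint 𝒳 G x) y * Real.log ((𝒳.card : ℝ) ^ Nt) -
          gaussDens (codePoint 𝒳 G x) y * Real.log (totalDens (codePoint 𝒳 G) y /
            gaussDens (codePoint 𝒳 G x) y)) / Real.log 2 := by
      intro y
      have hm : outputMarginal 𝒳 G y =
        ((𝒳.card : ℝ) ^ Nt)⁻¹ * totalDens (codePoint 𝒳 G) y := rfl
      have hd : outputDensity G (fun t => (x t : ℂ)) y = gaussDens (codePoint 𝒳 G x) y := rfl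
      have hg := gaussDens_pos (codePoint 𝒳 G x) y
      have ht := hg.trans_le (gaussDens_le_totalDens (codePoint 𝒳 G) x y)
      rw [hm, hd, Real.logb, Real.log_div hg.ne' (mul_pos (inv_pos.2 hc) ht).ne',
        Real.log_mul (inv_pos.2 hc).ne' ht.ne', Real.log_inv, Real.log_div ht.ne' hg.ne']
      ring
    simp_rw [hpt]
    rw [integral_div, integral_sub ((integrable_gaussDens _).mul_const _)
      (integrable_compEquiv _ x), integral_mul_const, integral_gaussDens, one_mul]
    rfl
  unfold mutualInfo
  simp_rw [key]
  rw [← Finset.sum_div, Finset.sum_sub_distrib]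
  simp only [Finset.sum_const, Finset.card_univ, Fintype.card_pi, Fintype.card_coe,
    Finset.prod_const, Fintype.card_fin, nsmul_eq_mul, Nat.cast_pow]
  field_simp

variable {𝒳} in
lemma le_mutualInfo_of_compEquiv_le (h0 : 0 < 𝒳.card) {c : ℝ}
    (h : ∀ x : Fin Nt → 𝒳, compEquiv (codePoint 𝒳 G) x ≤ c) :
    (Real.log ((𝒳.card : ℝ) ^ Nt) - c) / Real.log 2 ≤ mutualInfo 𝒳 G := by
  rw [mutualInfo_eq G h0]
  have hc : (0 : ℝ) < (𝒳.card : ℝ) ^ Nt := by positivity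
  have := Finset.sum_le_sum fun x (_ : x ∈ Finset.univ) => h x
  simp only [Finset.sum_const, Finset.card_univ, Fintype.card_pi, Fintype.card_coe,
    Finset.prod_const, Fintype.card_fin, nsmul_eq_mul, Nat.cast_pow] at this
  have h2 := mul_le_mul_of_nonneg_left this (inv_pos.2 hc).le
  rw [inv_mul_cancel_left₀ hc.ne'] at h2
  have := Real.log_pos one_lt_two
  gcongr

variable {𝒳} in
lemma mutualInfo_le_of_le_compEquiv (h0 : 0 < 𝒳.card) {c : ℝ}
    (h : ∀ x : Fin Nt → 𝒳, c ≤ compEquiv (codePoint 𝒳 G) x) :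
    mutualInfo 𝒳 G ≤ (Real.log ((𝒳.card : ℝ) ^ Nt) - c) / Real.log 2 := by
  rw [mutualInfo_eq G h0]
  have hc : (0 : ℝ) < (𝒳.card : ℝ) ^ Nt := by positivity
  have := Finset.sum_le_sum fun x (_ : x ∈ Finset.univ) => h x
  simp only [Finset.sum_const, Finset.card_univ, Fintype.card_pi, Fintype.card_coe,
    Finset.prod_const, Fintype.card_fin, nsmul_eq_mul, Nat.cast_pow] at this
  have h2 := mul_le_mul_of_nonneg_left this (inv_pos.2 hc).le
  rw [inv_mul_cancel_left₀ hc.ne'] at h2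
  have := Real.log_pos one_lt_two
  gcongr

lemma exists_card_mul_exp_le (k : ℝ) {ε : ℝ} (hε : 0 < ε) :
    ∃ A : ℝ, 0 < A ∧ k * Real.exp (-A / 4) ≤ ε := by
  have h : Tendsto (fun A : ℝ => k * Real.exp (-A / 4)) atTop (𝓝 (k * 0)) := by
    apply Tendsto.const_mul
    apply Real.tendsto_exp_atBot.comp
    have : (fun A : ℝ => -A / 4) = fun A => -(A * (1 / 4)) := by funext A; ring
    rw [this]
    exact tendsto_neg_atTop_atBot.comp (tendsto_id.atTop_mul_const (by norm_num))
  rw [mul_zero] at h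
  obtain ⟨A, h1, h2⟩ := ((h.eventually_lt_const hε).and (eventually_gt_atTop 0)).exists
  exact ⟨A, h2, h1.le⟩

variable {𝒳} in
lemma mutualInfo_nonneg (h0 : 0 < 𝒳.card) : 0 ≤ mutualInfo 𝒳 G := by
  have hl := Real.log_pos one_lt_two
  have hc : (0 : ℝ) < (𝒳.card : ℝ) ^ Nt := by positivity
  refine le_of_forall_pos_le_add fun ε hε => ?_
  -- With one cluster there are no distant components, so `A` is free and the error can be made
  -- arbitrarily small.
  obtain ⟨A, -, hA⟩ := exists_card_mul_exp_le ((𝒳.card : ℝ) ^ Nt) (mul_pos hε hl)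
  have h := le_mutualInfo_of_compEquiv_le G h0 (fun x => compEquiv_le (codePoint 𝒳 G)
    (fun _ => ()) (m := (𝒳.card : ℝ) ^ Nt) (A := A) hc x (by simp [Set.ncard_univ]) (by simp))
  simp only [Fintype.card_pi, Fintype.card_coe, Finset.prod_const, Finset.card_univ,
    Fintype.card_fin, Nat.cast_pow] at h
  rw [div_le_iff₀ hl] at h
  by_contra hn
  push Not at hn
  nlinarith

/-- The differences of codewords that the channel `G` maps to vectors of squared norm below `A`. -/
def killedDiffs (A : ℝ) : Set (Fin Nt → ℂ) :=
  {d | (∃ x x' : Fin Nt → 𝒳, d = fun t => (x t : ℂ) - x' t) ∧ ∑ r, ‖G.mulVec d r‖ ^ 2 < A}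

lemma sqDist_codePoint (x x' : Fin Nt → 𝒳) :
    sqDist (codePoint 𝒳 G x) (codePoint 𝒳 G x') =
      ∑ r, ‖G.mulVec (fun t => (x t : ℂ) - x' t) r‖ ^ 2 := by
  have : (fun t => (x t : ℂ) - x' t) = (fun t => (x t : ℂ)) - fun t => (x' t : ℂ) := rfl
  rw [this, Matrix.mulVec_sub]
  rfl

variable {𝒳} in
/-- Only the dimension of the span of the killed differences is lost. -/
lemma exists_le_mutualInfo (Nr Nt : ℕ) {M : ℝ} (hM : (𝒳.card : ℝ) = (2 : ℝ) ^ M) {ε : ℝ}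
    (hε : 0 < ε) : ∃ A : ℝ, 0 < A ∧ ∀ G : Matrix (Fin Nr) (Fin Nt) ℂ,
      ((Nt : ℝ) - Module.finrank ℂ (Submodule.span ℂ (killedDiffs 𝒳 G A))) * M - ε ≤
        mutualInfo 𝒳 G := by
  have hl := Real.log_pos one_lt_two
  have hc0 : (0 : ℝ) < 𝒳.card := by rw [hM]; positivity
  have h0 : 0 < 𝒳.card := by exact_mod_cast hc0
  obtain ⟨A, hA0, hA⟩ := exists_card_mul_exp_le ((𝒳.card : ℝ) ^ Nt) (mul_pos hε hl)
  refine ⟨A, hA0, fun G => ?_⟩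
  set W := Submodule.span ℂ (killedDiffs 𝒳 G A)
  set r := Module.finrank ℂ W
  -- The clusters are the cosets of `W`: codewords in different cosets have a difference that is not
  -- killed, hence outputs at squared distance at least `A`.
  have h := le_mutualInfo_of_compEquiv_le G h0 (fun x => compEquiv_le (codePoint 𝒳 G)
    (fun x => W.mkQ (fun t => (x t : ℂ))) (m := (𝒳.card : ℝ) ^ r) (A := A) (by positivity) x ?_ ?_)
  · have hlogc : Real.log 𝒳.card = M * Real.log 2 := by rw [hM, Real.log_rpow two_pos]
    simp only [Fintype.card_pi, Fintype.card_coe, Finset.prod_const, Finset.card_univ,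
      Fintype.card_fin, Nat.cast_pow, Real.log_pow, hlogc] at h
    rw [div_le_iff₀ hl] at h
    refine le_of_mul_le_mul_right ?_ hl
    linarith
  · have := ncard_coset_le 𝒳 W (fun t => (x t : ℂ)) h0
    simp only [Submodule.mkQ_apply, Submodule.Quotient.eq]
    exact_mod_cast this
  · intro x' hx'
    by_contra hn
    push Not at hn
    apply hx'
    simp only [Submodule.mkQ_apply]
    rw [eq_comm, Submodule.Quotient.eq]
    refine Submodule.subset_span ⟨⟨x, x', rfl⟩, ?_⟩
    rwa [sqDist_codePoint] at hn

variable {𝒳} in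
/-- Columns of small norm carry almost no information. -/
lemma exists_mutualInfo_le (Nr Nt : ℕ) {M : ℝ} (hM : (𝒳.card : ℝ) = (2 : ℝ) ^ M) {η : ℝ}
    (hη : 0 < η) : ∃ ρ : ℝ, 0 < ρ ∧ ∀ (G : Matrix (Fin Nr) (Fin Nt) ℂ) (T : Finset (Fin Nt)),
      (∀ r, ∀ t ∈ T, ‖G r t‖ ≤ ρ) → mutualInfo 𝒳 G ≤ ((Nt : ℝ) - T.card) * M + η := by
  classical
  have hl := Real.log_pos one_lt_two
  have hc0 : (0 : ℝ) < 𝒳.card := by rw [hM]; positivity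
  have h0 : 0 < 𝒳.card := by exact_mod_cast hc0
  have hlogc : Real.log 𝒳.card = M * Real.log 2 := by rw [hM, Real.log_rpow two_pos]
  set b : ℝ := ∑ z ∈ 𝒳, ‖z‖
  have hb : ∀ z : 𝒳, ‖(z : ℂ)‖ ≤ b := fun z =>
    Finset.single_le_sum (f := fun z : ℂ => ‖z‖) (fun _ _ => norm_nonneg _) z.2
  -- Bounds the squared distance of two outputs whose codewords differ only on columns with entries
  -- at most `ρ`.
  set bd : ℝ → ℝ := fun ρ => Nr * (Nt * (ρ * (b + b))) ^ 2
  have hcont : Tendsto (fun ρ : ℝ => 2 * (Real.exp (3 / 4 * bd ρ) - 1)) (𝓝[>] 0) (𝓝 0) := by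
    have : Continuous fun ρ : ℝ => 2 * (Real.exp (3 / 4 * bd ρ) - 1) := by fun_prop
    have h := (this.tendsto 0).mono_left (nhdsWithin_le_nhds (s := Set.Ioi 0))
    simpa [bd] using h
  obtain ⟨ρ, hρ1, hρ0⟩ := ((hcont.eventually_lt_const (mul_pos hη hl)).and
    self_mem_nhdsWithin).exists
  refine ⟨ρ, hρ0, fun G T hT => ?_⟩
  -- The codewords that agree with `x` outside `T`; the receiver can hardly tell them apart.
  let s : (Fin Nt → 𝒳) → Finset (Fin Nt → 𝒳) := fun x =>
    Fintype.piFinset fun t => if t ∈ T then Finset.univ else {x t}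
  have hs : ∀ x, (s x).card = 𝒳.card ^ T.card := by
    intro x
    simp only [s, Fintype.card_piFinset]
    have : ∀ t, (if t ∈ T then (Finset.univ : Finset 𝒳) else {x t}).card =
        if t ∈ T then 𝒳.card else 1 := by
      intro t; split_ifs <;> simp
    simp_rw [this]
    simp
  have hs' : ∀ x, (s x).Nonempty := fun x => ⟨x, by
    simp only [s, Fintype.mem_piFinset]
    intro t; split_ifs <;> simp⟩
  have hx : ∀ x, Real.log ((s x).card : ℝ) = T.card * (M * Real.log 2) := by
    intro x
    rw [hs]; push_cast; rw [Real.log_pow, hlogc]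
  have h := mutualInfo_le_of_le_compEquiv G h0
    (c := T.card * (M * Real.log 2) - 2 * (Real.exp (3 / 4 * bd ρ) - 1)) (fun x => by
      rw [← hx x]
      refine le_compEquiv (codePoint 𝒳 G) x (s x) (hs' x) (ε := bd ρ) ?_
      intro x' hx'
      rw [sqDist_codePoint]
      have hrow : ∀ r, ‖G.mulVec (fun t => (x t : ℂ) - x' t) r‖ ≤ Nt * (ρ * (b + b)) := by
        intro r
        simp only [Matrix.mulVec, dotProduct]
        calc ‖∑ t, G r t * ((x t : ℂ) - x' t)‖ ≤ ∑ t : Fin Nt, ρ * (b + b) := by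
              refine norm_sum_le_of_le _ fun t _ => ?_
              by_cases ht : t ∈ T
              · rw [norm_mul]
                gcongr
                · exact hT r t ht
                · exact (norm_sub_le _ _).trans (add_le_add (hb _) (hb _))
              · have := Fintype.mem_piFinset.1 hx' t
                simp only [if_neg ht, Finset.mem_singleton] at this
                have hb0 : 0 ≤ b := Finset.sum_nonneg fun _ _ => norm_nonneg _
                have : 0 < ρ := hρ0
                simp_all
          _ = _ := by simp
      calc ∑ r, ‖G.mulVec (fun t => (x t : ℂ) - x' t) r‖ ^ 2
          ≤ ∑ r : Fin Nr, (Nt * (ρ * (b + b))) ^ 2 := by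
            gcongr with r _
            exact hrow r
        _ = _ := by simp [bd])
  rw [Real.log_pow, hlogc, le_div_iff₀ hl] at h
  refine le_of_mul_le_mul_right ?_ hl
  linarith

lemma measurable_mutualInfo {α : Type*} [MeasurableSpace α]
    {H : α → Matrix (Fin Nr) (Fin Nt) ℂ} (hH : ∀ r t, Measurable fun a => H a r t) :
    Measurable fun a => mutualInfo 𝒳 (H a) := by
  have hd : ∀ x : Fin Nt → ℂ, Measurable fun p : α × (Fin Nr → ℂ) =>
      outputDensity (H p.1) x p.2 := by
    intro x
    unfold outputDensity
    simp only [Matrix.mulVec, dotProduct]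
    fun_prop
  have hmarg : Measurable fun p : α × (Fin Nr → ℂ) => outputMarginal 𝒳 (H p.1) p.2 := by
    unfold outputMarginal
    fun_prop
  unfold mutualInfo
  refine (Finset.measurable_sum _ fun x _ => ?_).const_mul _
  refine StronglyMeasurable.measurable ?_
  refine StronglyMeasurable.integral_prod_right' (f := fun p : α × (Fin Nr → ℂ) =>
    outputDensity (H p.1) (fun t => (x t : ℂ)) p.2 * Real.logb 2
      (outputDensity (H p.1) (fun t => (x t : ℂ)) p.2 / outputMarginal 𝒳 (H p.1) p.2)) ?_
  refine Measurable.stronglyMeasurable ?_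
  have := hd (fun t => (x t : ℂ))
  unfold Real.logb
  fun_prop

end MutualInfo

/-! ## Small-ball probabilities of the complex Gaussian law -/

lemma gaussianReal_half_Icc_le (a b : ℝ) :
    gaussianReal 0 (1 / 2) (Set.Icc a b) ≤ ENNReal.ofReal (b - a) := by
  rw [gaussianReal_apply _ (by norm_num)]
  calc ∫⁻ x in Set.Icc a b, gaussianPDF 0 (1 / 2) x ≤ ∫⁻ x in Set.Icc a b, 1 := by
        refine lintegral_mono fun x => ?_
        rw [gaussianPDF, ← ENNReal.ofReal_one]
        apply ENNReal.ofReal_le_ofReal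
        unfold gaussianPDFReal
        have h1 : 1 ≤ √(2 * Real.pi * ((1 / 2 : NNReal) : ℝ)) := by
          rw [Real.one_le_sqrt]
          push_cast
          nlinarith [Real.pi_gt_three]
        refine mul_le_one₀ (inv_le_one_of_one_le₀ h1) (Real.exp_pos _).le ?_
        rw [Real.exp_le_one_iff]
        have : 0 ≤ (x - 0) ^ 2 := sq_nonneg _
        push_cast
        linarith
    _ = ENNReal.ofReal (b - a) := by simp

lemma exists_le_gaussianReal_half_Icc : ∃ c : ℝ, 0 < c ∧ ∀ s : ℝ, 0 ≤ s → s ≤ 1 →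
    ENNReal.ofReal (c * s) ≤ gaussianReal 0 (1 / 2) (Set.Icc (-s) s) := by
  refine ⟨2 * ((√(2 * Real.pi * ((1 / 2 : NNReal) : ℝ)))⁻¹ * Real.exp (-1)), by positivity,
    fun s hs0 hs1 => ?_⟩
  rw [gaussianReal_apply _ (by norm_num)]
  calc ENNReal.ofReal (2 * ((√(2 * Real.pi * ((1 / 2 : NNReal) : ℝ)))⁻¹ * Real.exp (-1)) * s)
      = ∫⁻ x in Set.Icc (-s) s, ENNReal.ofReal
        ((√(2 * Real.pi * ((1 / 2 : NNReal) : ℝ)))⁻¹ * Real.exp (-1)) := by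
        rw [setLIntegral_const, Real.volume_Icc, ← ENNReal.ofReal_mul (by positivity)]
        ring_nf
    _ ≤ _ := by
        refine setLIntegral_mono' measurableSet_Icc fun x hx => ?_
        rw [gaussianPDF]
        apply ENNReal.ofReal_le_ofReal
        unfold gaussianPDFReal
        gcongr
        have : (x - 0) ^ 2 ≤ 1 := by
          rw [sub_zero, sq_le_one_iff_abs_le_one, abs_le]
          exact ⟨by linarith [hx.1], by linarith [hx.2]⟩
        push_cast
        linarith

lemma stdComplexGaussian_apply {s : Set ℂ} (hs : MeasurableSet s) : stdComplexGaussian s =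
    ((gaussianReal 0 (1 / 2)).prod (gaussianReal 0 (1 / 2)))
      (Complex.measurableEquivRealProd.symm ⁻¹' s) := by
  rw [stdComplexGaussian, Measure.map_apply Complex.measurableEquivRealProd.symm.measurable hs]

lemma stdComplexGaussian_closedBall_le (z : ℂ) {s : ℝ} (hs : 0 ≤ s) :
    stdComplexGaussian (Metric.closedBall z s) ≤ ENNReal.ofReal (4 * s ^ 2) := by
  rw [stdComplexGaussian_apply Metric.isClosed_closedBall.measurableSet]
  calc _ ≤ ((gaussianReal 0 (1 / 2)).prod (gaussianReal 0 (1 / 2)))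
        (Set.Icc (z.re - s) (z.re + s) ×ˢ Set.Icc (z.im - s) (z.im + s)) := by
        apply measure_mono
        rintro ⟨x, y⟩ h
        simp only [Set.mem_preimage, Metric.mem_closedBall, dist_eq_norm] at h
        have h1 := (Complex.abs_re_le_norm _).trans h
        have h2 := (Complex.abs_im_le_norm _).trans h
        simp only [Complex.sub_re, Complex.sub_im, Complex.measurableEquivRealProd_symm_apply,
          abs_le] at h1 h2
        exact ⟨⟨by linarith [h1.1], by linarith [h1.2]⟩, ⟨by linarith [h2.1], by linarith [h2.2]⟩⟩
    _ ≤ ENNReal.ofReal (2 * s) * ENNReal.ofReal (2 * s) := by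
        rw [Measure.prod_prod]
        gcongr
        · exact (gaussianReal_half_Icc_le _ _).trans (ENNReal.ofReal_le_ofReal (by linarith))
        · exact (gaussianReal_half_Icc_le _ _).trans (ENNReal.ofReal_le_ofReal (by linarith))
    _ = _ := by
        rw [← ENNReal.ofReal_mul (by positivity)]
        ring_nf

lemma exists_le_stdComplexGaussian_closedBall : ∃ c : ℝ, 0 < c ∧ ∀ s : ℝ, 0 ≤ s → s ≤ 1 →
    ENNReal.ofReal (c * s ^ 2) ≤ stdComplexGaussian (Metric.closedBall 0 s) := by
  obtain ⟨c, hc, h⟩ := exists_le_gaussianReal_half_Icc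
  refine ⟨c / 2 * (c / 2), by positivity, fun s hs0 hs1 => ?_⟩
  rw [stdComplexGaussian_apply Metric.isClosed_closedBall.measurableSet]
  calc ENNReal.ofReal (c / 2 * (c / 2) * s ^ 2)
      = ENNReal.ofReal (c * (s / 2)) * ENNReal.ofReal (c * (s / 2)) := by
        rw [← ENNReal.ofReal_mul (by positivity)]
        ring_nf
    _ ≤ ((gaussianReal 0 (1 / 2)).prod (gaussianReal 0 (1 / 2)))
        (Set.Icc (-(s / 2)) (s / 2) ×ˢ Set.Icc (-(s / 2)) (s / 2)) := by
        rw [Measure.prod_prod]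
        gcongr <;> exact h _ (by linarith) (by linarith)
    _ ≤ _ := by
        apply measure_mono
        rintro ⟨x, y⟩ ⟨⟨hx1, hx2⟩, hy1, hy2⟩
        simp only [Set.mem_preimage, Metric.mem_closedBall, dist_zero_right]
        refine (Complex.norm_le_abs_re_add_abs_im _).trans ?_
        simp only [Complex.measurableEquivRealProd_symm_apply]
        have h1 := abs_le.2 ⟨hx1, hx2⟩
        have h2 := abs_le.2 ⟨hy1, hy2⟩
        linarith

/-! ## A Gaussian combination of vectors spanning `k` dimensions -/

/-- Fubini with two crude bounds: where a section can be nonempty, and how large it can be. -/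
lemma prod_measure_le_of_section_le {α β : Type*} [MeasurableSpace α] [MeasurableSpace β]
    (μ : Measure α) (ν : Measure β) [SFinite μ] [SFinite ν] {T : Set (α × β)}
    (hT : MeasurableSet T) {U : Set β} (hU : MeasurableSet U) (c : ENNReal)
    (h : ∀ y, ((fun x => (x, y)) ⁻¹' T).Nonempty → y ∈ U)
    (h' : ∀ y, μ ((fun x => (x, y)) ⁻¹' T) ≤ c) :
    (μ.prod ν) T ≤ c * ν U := by
  rw [Measure.prod_apply_symm hT, ← lintegral_indicator_const hU]
  refine lintegral_mono fun y => ?_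
  by_cases hy : y ∈ U
  · simpa [hy] using h' y
  · have : (fun x => (x, y)) ⁻¹' T = ∅ := by
      by_contra hne
      exact hy (h y (Set.nonempty_iff_ne_empty.2 hne))
    simp [this]

section RowBall

variable {F : Type*} [NormedAddCommGroup F] [NormedSpace ℂ F]

lemma measurableSet_norm_sum_smul_le {n : ℕ} (v : Fin n → F) (s : ℝ) :
    MeasurableSet {h : Fin n → ℂ | ‖∑ i, h i • v i‖ ≤ s} :=
  (isClosed_le (by fun_prop) continuous_const).measurableSet

/-- Induction on the number of vectors. If `v 0 ≠ 0`, the other coefficients must make the sum small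
modulo `v 0`, where at least `k - 1` dimensions survive. Given them, the first coefficient lies in a
disc of radius `O(s)`, which contributes the factor `s ^ 2`. -/
lemma exists_pi_norm_sum_smul_le [FiniteDimensional ℂ F] (n k : ℕ) (v : Fin n → F)
    (hk : k ≤ Module.finrank ℂ (Submodule.span ℂ (Set.range v))) :
    ∃ C : ℝ, 0 ≤ C ∧ ∀ s : ℝ, 0 ≤ s →
      Measure.pi (fun _ : Fin n => stdComplexGaussian) {h | ‖∑ i, h i • v i‖ ≤ s} ≤
        ENNReal.ofReal (C * s ^ (2 * k)) := by
  induction n generalizing k with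
  | zero =>
    have h0 : Module.finrank ℂ (Submodule.span ℂ (Set.range v)) = 0 := by
      rw [Set.range_eq_empty v, Submodule.span_empty, finrank_bot]
    obtain rfl : k = 0 := by omega
    refine ⟨1, zero_le_one, fun s _ => ?_⟩
    simpa using prob_le_one
  | succ n ih =>
    let T : ℝ → Set (ℂ × (Fin n → ℂ)) := fun s =>
      {p | ‖p.1 • v 0 + ∑ i, p.2 i • v i.succ‖ ≤ s}
    have hTm : ∀ s, MeasurableSet (T s) := fun s =>
      (isClosed_le (by fun_prop) continuous_const).measurableSet
    have hmp := measurePreserving_piFinSuccAbove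
      (fun _ : Fin (n + 1) => stdComplexGaussian) 0
    have heq : ∀ s, Measure.pi (fun _ : Fin (n + 1) => stdComplexGaussian)
        {h | ‖∑ i, h i • v i‖ ≤ s} = (stdComplexGaussian.prod
          (Measure.pi fun _ : Fin n => stdComplexGaussian)) (T s) := by
      intro s
      rw [← hmp.measure_preimage (hTm s).nullMeasurableSet]
      congr 1
      ext h
      simp only [Set.mem_ofPred_eq, Set.mem_preimage, T, Fin.sum_univ_succ]
      rfl
    by_cases hv : v 0 = 0
    · have hspan : Submodule.span ℂ (Set.range v) =
          Submodule.span ℂ (Set.range fun i : Fin n => v i.succ) := by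
        rw [← Fin.cons_self_tail v, Fin.range_cons, hv, Submodule.span_insert_zero]
        rfl
      rw [hspan] at hk
      obtain ⟨C, hC, h⟩ := ih k (fun i : Fin n => v i.succ) hk
      refine ⟨C, hC, fun s hs => ?_⟩
      rw [heq]
      refine (prod_measure_le_of_section_le _ _ (hTm s)
        (measurableSet_norm_sum_smul_le (fun i : Fin n => v i.succ) s) 1 ?_ fun _ => prob_le_one).trans ?_
      · rintro y ⟨z, hz⟩
        simpa [T, hv] using hz
      · rw [one_mul]
        exact h s hs
    · cases k with
      | zero => exact ⟨1, zero_le_one, fun s _ => by simpa using prob_le_one⟩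
      | succ k =>
        -- Since `f (v 0) = 1`, the map `x ↦ x - f x • v 0` is a bounded projection that kills `v 0`
        -- and sends `v i.succ` to `w i`; its norm is at most `q`.
        obtain ⟨f, hf⟩ := SeparatingDual.exists_eq_one (R := ℂ) hv
        let w : Fin n → F := fun i => v i.succ - f (v i.succ) • v 0
        have hsup : Submodule.span ℂ (Set.range v) ≤
            Submodule.span ℂ {v 0} ⊔ Submodule.span ℂ (Set.range w) := by
          rw [Submodule.span_le]
          rintro _ ⟨i, rfl⟩
          have h0 : v 0 ∈ Submodule.span ℂ {v 0} := Submodule.mem_span_singleton_self _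
          refine Fin.cases (Submodule.mem_sup_left h0) (fun i => ?_) i
          have : v i.succ = f (v i.succ) • v 0 + w i := by simp [w]
          rw [this]
          exact Submodule.add_mem_sup (Submodule.smul_mem _ _ h0)
            (Submodule.subset_span ⟨i, rfl⟩)
        have hk' : k ≤ Module.finrank ℂ (Submodule.span ℂ (Set.range w)) := by
          have h1 := Submodule.finrank_mono hsup
          have h2 := Submodule.finrank_add_le_finrank_add_finrank
            (Submodule.span ℂ {v 0}) (Submodule.span ℂ (Set.range w))
          rw [finrank_span_singleton hv] at h2
          omega
        obtain ⟨C, hC, h⟩ := ih k _ hk'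
        set q : ℝ := 1 + ‖f‖ * ‖v 0‖
        have hv' : 0 < ‖v 0‖ := norm_pos_iff.2 hv
        refine ⟨4 * (2 / ‖v 0‖) ^ 2 * (C * q ^ (2 * k)), by positivity, fun s hs => ?_⟩
        rw [heq]
        refine (prod_measure_le_of_section_le _ _ (hTm s)
          (measurableSet_norm_sum_smul_le w (q * s))
          (ENNReal.ofReal (4 * (2 * s / ‖v 0‖) ^ 2)) ?_ ?_).trans ?_
        · rintro y ⟨z, hz⟩
          have hz' : ‖z • v 0 + ∑ i, y i • v i.succ‖ ≤ s := hz
          set x := z • v 0 + ∑ i, y i • v i.succ with hx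
          have hw : ∑ i, y i • w i = x - f x • v 0 := by
            simp only [w, hx, map_add, map_smul, map_sum, hf, smul_eq_mul, mul_one, smul_sub,
              Finset.sum_sub_distrib, add_smul, Finset.sum_smul, mul_smul]
            abel
          rw [Set.mem_ofPred_eq, hw]
          calc ‖x - f x • v 0‖ ≤ ‖x‖ + ‖f‖ * ‖x‖ * ‖v 0‖ := by
                refine (norm_sub_le _ _).trans ?_
                rw [norm_smul]
                gcongr
                exact f.le_opNorm x
            _ = q * ‖x‖ := by simp only [q]; ring
            _ ≤ q * s := by gcongr
        · intro y
          rcases Set.eq_empty_or_nonempty ((fun x => (x, y)) ⁻¹' T s) with he | ⟨z₀, hz₀⟩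
          · rw [he]; simp
          -- Any two points of a section differ by at most `2 * s / ‖v 0‖`, so one of them can serve
          -- as the centre of a disc.
          · refine le_trans (measure_mono ?_)
              (stdComplexGaussian_closedBall_le z₀ (s := 2 * s / ‖v 0‖) (by positivity))
            intro z hz
            have h1 : ‖z • v 0 + ∑ i, y i • v i.succ‖ ≤ s := hz
            have h2 : ‖z₀ • v 0 + ∑ i, y i • v i.succ‖ ≤ s := hz₀
            rw [Metric.mem_closedBall, dist_eq_norm, le_div_iff₀ hv', ← norm_smul]
            calc ‖(z - z₀) • v 0‖ = ‖(z • v 0 + ∑ i, y i • v i.succ) -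
                  (z₀ • v 0 + ∑ i, y i • v i.succ)‖ := by rw [sub_smul]; congr 1; abel
              _ ≤ s + s := (norm_sub_le _ _).trans (add_le_add h1 h2)
              _ = 2 * s := by ring
        · refine (mul_le_mul_right (h (q * s) (by positivity)) _).trans ?_
          rw [← ENNReal.ofReal_mul (by positivity)]
          apply ENNReal.ofReal_le_ofReal
          apply le_of_eq
          rw [mul_pow q s, mul_add 2 k 1, pow_add]
          ring

end RowBall

/-! ## Outage exponents of one round -/

/-- The law of the fading matrix of one block. -/
def blockLaw (Nr Nt : ℕ) : Measure (Fin Nr → Fin Nt → ℂ) :=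
  Measure.pi fun _ => Measure.pi fun _ => stdComplexGaussian

instance (Nr Nt : ℕ) : IsProbabilityMeasure (blockLaw Nr Nt) := by
  unfold blockLaw; infer_instance

/-- The gain matrix of a block at transmit power `p`. -/
def gainMatrix {Nr Nt : ℕ} (p : ℝ) (h : Fin Nr → Fin Nt → ℂ) : Matrix (Fin Nr) (Fin Nt) ℂ :=
  ((Real.sqrt (p / Nt) : ℝ) : ℂ) • Matrix.of h

/-- The dimension of the space spanned by the codeword differences lost by the channel `G`. -/
def lostDim (𝒳 : Finset ℂ) {Nr Nt : ℕ} (A : ℝ) (G : Matrix (Fin Nr) (Fin Nt) ℂ) : ℕ :=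
  Module.finrank ℂ (Submodule.span ℂ (killedDiffs 𝒳 G A))

lemma lostDim_le (𝒳 : Finset ℂ) {Nr Nt : ℕ} (A : ℝ) (G : Matrix (Fin Nr) (Fin Nt) ℂ) :
    lostDim 𝒳 A G ≤ Nt :=
  (Submodule.finrank_le _).trans (by simp)

lemma gainMatrix_mulVec {Nr Nt : ℕ} (p : ℝ) (h : Fin Nr → Fin Nt → ℂ) (d : Fin Nt → ℂ)
    (r : Fin Nr) : (gainMatrix p h).mulVec d r = (Real.sqrt (p / Nt) : ℝ) * ∑ t, h r t * d t := by
  rw [gainMatrix, Matrix.smul_mulVec]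
  rfl

/-- Difference of a pair of codewords. -/
def pairDiff {𝒳 : Finset ℂ} {Nt : ℕ} (q : (Fin Nt → 𝒳) × (Fin Nt → 𝒳)) : Fin Nt → ℂ :=
  fun t => (q.1 t : ℂ) - q.2 t

/-- The vector of `t`-th coordinates of the differences in `D`. -/
def diffColumn {𝒳 : Finset ℂ} {Nt : ℕ} (D : Finset ((Fin Nt → 𝒳) × (Fin Nt → 𝒳)))
    (t : Fin Nt) : D → ℂ := fun q => pairDiff q.1 t

/-- Row rank equals column rank. This turns the dimension of the lost differences into the dimension
spanned by the vectors that a row of the fading matrix combines. -/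
lemma finrank_span_diffColumn {𝒳 : Finset ℂ} {Nt : ℕ}
    (D : Finset ((Fin Nt → 𝒳) × (Fin Nt → 𝒳))) :
    Module.finrank ℂ (Submodule.span ℂ (Set.range (diffColumn D))) =
      Module.finrank ℂ (Submodule.span ℂ (pairDiff '' (D : Set ((Fin Nt → 𝒳) × (Fin Nt → 𝒳))))) := by
  have h1 := Matrix.rank_eq_finrank_span_cols (Matrix.of fun (q : D) t => pairDiff q.1 t)
  have h2 := Matrix.rank_eq_finrank_span_row (Matrix.of fun (q : D) t => pairDiff q.1 t)
  rw [h1] at h2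
  rw [Set.image_eq_range]
  exact h2

/-- There are finitely many possible sets `D` of killed pairs. For each, every row of the fading
matrix gives a combination of the columns of `D` of size `O(p ^ (-1/2))`, with probability `O(p ^
(-k))`; the `Nr` rows are independent. -/
lemma exists_blockLaw_lostDim_le (𝒳 : Finset ℂ) (Nr : ℕ) {Nt : ℕ} (hNt : 0 < Nt) {A : ℝ}
    (hA : 0 < A) (k : ℕ) : ∃ C : ℝ, 1 ≤ C ∧ ∀ p : ℝ, 0 < p →
      blockLaw Nr Nt {h | k ≤ lostDim 𝒳 A (gainMatrix p h)} ≤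
        ENNReal.ofReal (C * (p ^ (Nr * k))⁻¹) := by
  classical
  have hD : ∀ D : Finset ((Fin Nt → 𝒳) × (Fin Nt → 𝒳)), ∃ C : ℝ, 0 ≤ C ∧ ∀ s : ℝ, 0 ≤ s →
      k ≤ Module.finrank ℂ (Submodule.span ℂ (Set.range (diffColumn D))) →
      Measure.pi (fun _ : Fin Nt => stdComplexGaussian) {h | ‖∑ i, h i • diffColumn D i‖ ≤ s} ≤
        ENNReal.ofReal (C * s ^ (2 * k)) := by
    intro D
    by_cases hk : k ≤ Module.finrank ℂ (Submodule.span ℂ (Set.range (diffColumn D)))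
    · obtain ⟨C, hC, h⟩ := exists_pi_norm_sum_smul_le Nt k (diffColumn D) hk
      exact ⟨C, hC, fun s hs _ => h s hs⟩
    · exact ⟨0, le_rfl, fun s hs h => absurd h hk⟩
  choose C hC0 hC using hD
  have hNt' : (0 : ℝ) < Nt := by exact_mod_cast hNt
  refine ⟨1 + ∑ D, (C D * (A * Nt) ^ k) ^ Nr, ?_, fun p hp => ?_⟩
  · have : 0 ≤ ∑ D, (C D * (A * Nt) ^ k) ^ Nr := Finset.sum_nonneg fun D _ => by
      have := hC0 D
      positivity
    linarith
  set s := √(A * Nt / p) with hs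
  have hs2 : s ^ (2 * k) = (A * Nt) ^ k * (p ^ k)⁻¹ := by
    rw [pow_mul, Real.sq_sqrt (by positivity), div_pow, div_eq_mul_inv]
  let E : Finset ((Fin Nt → 𝒳) × (Fin Nt → 𝒳)) → Set (Fin Nr → Fin Nt → ℂ) := fun D =>
    {h | k ≤ Module.finrank ℂ (Submodule.span ℂ (Set.range (diffColumn D))) ∧
      ∀ r, ‖∑ i, h r i • diffColumn D i‖ ≤ s}
  have hsub : {h : Fin Nr → Fin Nt → ℂ | k ≤ lostDim 𝒳 A (gainMatrix p h)} ⊆ ⋃ D, E D := by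
    intro h hh
    rw [Set.mem_iUnion]
    set D : Finset ((Fin Nt → 𝒳) × (Fin Nt → 𝒳)) := Finset.univ.filter fun q =>
      ∑ r, ‖(gainMatrix p h).mulVec (pairDiff q) r‖ ^ 2 < A with hDdef
    have hk : killedDiffs 𝒳 (gainMatrix p h) A = 
        pairDiff '' (D : Set ((Fin Nt → 𝒳) × (Fin Nt → 𝒳))) := by
      ext d
      constructor
      · rintro ⟨⟨x, x', rfl⟩, h2⟩
        exact ⟨(x, x'), Finset.mem_coe.2 (Finset.mem_filter.2 ⟨Finset.mem_univ _, h2⟩), rfl⟩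
      · rintro ⟨⟨x, x'⟩, h2, rfl⟩
        exact ⟨⟨x, x', rfl⟩, by simpa [hDdef, pairDiff] using h2⟩
    refine ⟨D, ?_, fun r => ?_⟩
    · rw [finrank_span_diffColumn, ← hk]
      exact hh
    · rw [pi_norm_le_iff_of_nonneg (Real.sqrt_nonneg _)]
      rintro ⟨q, hq⟩
      have hq' : ∑ r, ‖(gainMatrix p h).mulVec (pairDiff q) r‖ ^ 2 < A := by
        simpa [hDdef] using hq
      have h1 : ‖(gainMatrix p h).mulVec (pairDiff q) r‖ ^ 2 ≤ A :=
        (Finset.single_le_sum (f := fun r => ‖(gainMatrix p h).mulVec (pairDiff q) r‖ ^ 2)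
          (fun _ _ => by positivity) (Finset.mem_univ r)).trans hq'.le
      rw [gainMatrix_mulVec, norm_mul, mul_pow, Complex.norm_real,
        Real.norm_of_nonneg (Real.sqrt_nonneg _), Real.sq_sqrt (by positivity)] at h1
      have h2 : (∑ i, h r i • diffColumn D i) ⟨q, hq⟩ = ∑ t, h r t * pairDiff q t := by
        simp [diffColumn]
      rw [h2]
      apply Real.le_sqrt_of_sq_le
      rw [le_div_iff₀ hp]
      rw [div_mul_eq_mul_div, div_le_iff₀ hNt'] at h1
      linarith
  have hE : ∀ D, blockLaw Nr Nt (E D) ≤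
      ENNReal.ofReal ((C D * (A * Nt) ^ k) ^ Nr * (p ^ (Nr * k))⁻¹) := by
    intro D
    by_cases hk : k ≤ Module.finrank ℂ (Submodule.span ℂ (Set.range (diffColumn D)))
    · have heq : E D = Set.univ.pi fun _ => {h | ‖∑ i, h i • diffColumn D i‖ ≤ s} := by
        ext h
        simp [E, hk]
      rw [heq, blockLaw, Measure.pi_pi, Finset.prod_const, Finset.card_univ, Fintype.card_fin]
      calc _ ≤ ENNReal.ofReal (C D * s ^ (2 * k)) ^ Nr := by
            gcongr
            exact hC D s (Real.sqrt_nonneg _) hk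
        _ = _ := by
            have := hC0 D
            rw [← ENNReal.ofReal_pow (by positivity), hs2, ← mul_assoc, mul_pow, inv_pow,
              ← pow_mul, mul_comm k Nr]
    · have : E D = ∅ := by
        ext h
        simp [E, hk]
      rw [this]
      simp
  calc _ ≤ blockLaw Nr Nt (⋃ D, E D) := measure_mono hsub
    _ ≤ ∑ D, blockLaw Nr Nt (E D) := measure_iUnion_fintype_le _ _
    _ ≤ ∑ D, ENNReal.ofReal ((C D * (A * Nt) ^ k) ^ Nr * (p ^ (Nr * k))⁻¹) :=
        Finset.sum_le_sum fun D _ => hE D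
    _ = ENNReal.ofReal (∑ D, (C D * (A * Nt) ^ k) ^ Nr * (p ^ (Nr * k))⁻¹) := by
        rw [ENNReal.ofReal_sum_of_nonneg]
        intro D _
        have := hC0 D
        positivity
    _ ≤ _ := by
        apply ENNReal.ofReal_le_ofReal
        rw [← Finset.sum_mul]
        gcongr
        linarith

lemma roundLaw_eq (B Nr Nt : ℕ) : roundLaw B Nr Nt = Measure.pi fun _ => blockLaw Nr Nt := rfl

/-- With loss `δ`, a round at power `p` provides at most `i` symbols with probability
`O(p ^ (-Nr (B Nt - i)))`. -/
lemma exists_roundLaw_roundInfo_lt_le {𝒳 : Finset ℂ} {B Nr Nt : ℕ} (hB : 0 < B) (hNt : 0 < Nt)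
    {M : ℝ} (hM : (𝒳.card : ℝ) = (2 : ℝ) ^ M) (hM0 : 0 < M) {δ : ℝ} (hδ : 0 < δ) :
    ∃ C : ℝ, 1 ≤ C ∧ ∀ p : ℝ, 0 < p → ∀ i : ℕ,
      (roundLaw B Nr Nt).real {h | roundInfo 𝒳 p h < (i + 1) * (M / B) - δ} ≤
        C * (p ^ (Nr * (B * Nt - i)))⁻¹ := by
  obtain ⟨A, hA, hMI⟩ := exists_le_mutualInfo (𝒳 := 𝒳) Nr Nt hM hδ
  choose Ck hCk1 hCk using fun k => exists_blockLaw_lostDim_le 𝒳 Nr hNt hA k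
  set C₀ := ∑ k ∈ Finset.range (Nt + 1), Ck k with hC₀
  have hCk0 : ∀ k, 0 ≤ Ck k := fun k => zero_le_one.trans (hCk1 k)
  have hle : ∀ k ∈ Finset.range (Nt + 1), Ck k ≤ C₀ := fun k hk =>
    Finset.single_le_sum (fun k _ => hCk0 k) hk
  have hC₀1 : 1 ≤ C₀ := (hCk1 0).trans (hle 0 (by simp))
  set m : ℝ := (Fintype.card (Fin B → Fin (Nt + 1)) : ℝ)
  have hm : 1 ≤ m := by
    have : 0 < Fintype.card (Fin B → Fin (Nt + 1)) := Fintype.card_pos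
    simp only [m]
    exact_mod_cast this
  have hmC : 1 ≤ m * C₀ ^ B := one_le_mul_of_one_le_of_one_le hm (one_le_pow₀ hC₀1)
  refine ⟨m * C₀ ^ B, hmC, fun p hp i => ?_⟩
  have hB' : (0 : ℝ) < B := by exact_mod_cast hB
  -- For `p < 1` the claimed bound is at least `1`.
  rcases lt_or_ge p 1 with hp1 | hp1
  · refine measureReal_le_one.trans (one_le_mul_of_one_le_of_one_le hmC ?_)
    exact one_le_inv_iff₀.2 ⟨by positivity, pow_le_one₀ hp.le hp1.le⟩
  -- `κ` prescribes lower bounds for the losses of the blocks, which are independent; there are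
  -- finitely many choices of `κ`.
  let E : (Fin B → Fin (Nt + 1)) → Set (RoundGain B Nr Nt) := fun κ =>
    {h | B * Nt - i ≤ ∑ b, (κ b : ℕ) ∧ ∀ b, (κ b : ℕ) ≤ lostDim 𝒳 A (gainMatrix p (h b))}
  have hsub : {h : RoundGain B Nr Nt | roundInfo 𝒳 p h < (i + 1) * (M / B) - δ} ⊆ ⋃ κ, E κ := by
    intro h hh
    rw [Set.mem_iUnion]
    refine ⟨fun b => ⟨lostDim 𝒳 A (gainMatrix p (h b)), Nat.lt_succ_of_le (lostDim_le _ _ _)⟩,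
      ?_, fun b => le_rfl⟩
    simp only
    have h1 : ∑ b : Fin B, (((Nt : ℝ) - lostDim 𝒳 A (gainMatrix p (h b))) * M - δ) ≤
        ∑ b, mutualInfo 𝒳 (gainMatrix p (h b)) :=
      Finset.sum_le_sum fun b _ => hMI (gainMatrix p (h b))
    have h2 : (B : ℝ)⁻¹ * ∑ b, mutualInfo 𝒳 (gainMatrix p (h b)) < (i + 1) * (M / B) - δ := hh
    rw [inv_mul_lt_iff₀ hB'] at h2
    rw [Finset.sum_sub_distrib, ← Finset.sum_mul, Finset.sum_sub_distrib] at h1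
    simp only [Finset.sum_const, Finset.card_univ, Fintype.card_fin, nsmul_eq_mul] at h1
    have h3 : (B : ℝ) * ((i + 1) * (M / B) - δ) = (i + 1) * M - B * δ := by field_simp
    rw [h3] at h2
    have h4 : ((B : ℝ) * Nt - ∑ b, (lostDim 𝒳 A (gainMatrix p (h b)) : ℝ)) < i + 1 := by
      refine lt_of_mul_lt_mul_right ?_ hM0.le
      linarith
    -- A strict inequality between integers: this is where the real information deficit becomes a
    -- whole number of lost symbols.
    have h5 : B * Nt < i + 1 + ∑ b, lostDim 𝒳 A (gainMatrix p (h b)) := by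
      have : ((B * Nt : ℕ) : ℝ) < ((i + 1 + ∑ b, lostDim 𝒳 A (gainMatrix p (h b)) : ℕ) : ℝ) := by
        push_cast
        linarith
      exact_mod_cast this
    omega
  have hE : ∀ κ, roundLaw B Nr Nt (E κ) ≤
      ENNReal.ofReal (C₀ ^ B * (p ^ (Nr * (B * Nt - i)))⁻¹) := by
    intro κ
    by_cases hκ : B * Nt - i ≤ ∑ b, (κ b : ℕ)
    · have heq : E κ = Set.univ.pi fun b =>
          {h | (κ b : ℕ) ≤ lostDim 𝒳 A (gainMatrix p h)} := by
        ext h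
        simp only [E, hκ, true_and, Set.mem_pi, Set.mem_univ, true_imp_iff]
        rfl
      rw [heq, roundLaw_eq, Measure.pi_pi]
      calc _ ≤ ∏ b, ENNReal.ofReal (C₀ * (p ^ (Nr * (κ b : ℕ)))⁻¹) := by
            gcongr with b _
            refine (hCk (κ b) p hp).trans (ENNReal.ofReal_le_ofReal ?_)
            gcongr
            exact hle _ (Finset.mem_range.2 (κ b).2)
        _ = ENNReal.ofReal (∏ b, (C₀ * (p ^ (Nr * (κ b : ℕ)))⁻¹)) := by
            rw [ENNReal.ofReal_prod_of_nonneg]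
            intro b _
            positivity
        _ ≤ _ := by
            apply ENNReal.ofReal_le_ofReal
            rw [Finset.prod_mul_distrib, Finset.prod_inv_distrib, Finset.prod_pow_eq_pow_sum,
              ← Finset.mul_sum]
            simp only [Finset.prod_const, Finset.card_univ, Fintype.card_fin]
            gcongr
    · have : E κ = ∅ := Set.eq_empty_of_forall_notMem fun h hh => hκ hh.1
      rw [this]
      simp
  have hfin : roundLaw B Nr Nt {h | roundInfo 𝒳 p h < (i + 1) * (M / B) - δ} ≤
      ENNReal.ofReal (m * C₀ ^ B * (p ^ (Nr * (B * Nt - i)))⁻¹) := by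
    calc _ ≤ roundLaw B Nr Nt (⋃ κ, E κ) := measure_mono hsub
      _ ≤ ∑ κ, roundLaw B Nr Nt (E κ) := measure_iUnion_fintype_le _ _
      _ ≤ ∑ κ : Fin B → Fin (Nt + 1), ENNReal.ofReal (C₀ ^ B * (p ^ (Nr * (B * Nt - i)))⁻¹) :=
          Finset.sum_le_sum fun κ _ => hE κ
      _ = _ := by
          rw [Finset.sum_const, Finset.card_univ, nsmul_eq_mul, mul_assoc m,
            ENNReal.ofReal_mul (p := m) (by positivity), ENNReal.ofReal_natCast]
  exact ENNReal.toReal_le_of_le_ofReal (by positivity) hfin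

/-- A round of power at most `x` loses `D` symbols with probability of order at least
`x ^ (-Nr D)`. -/
lemma exists_le_roundLaw_roundInfo_le {𝒳 : Finset ℂ} {B Nr Nt : ℕ} (hB : 0 < B) (hNt : 0 < Nt)
    {M : ℝ} (hM : (𝒳.card : ℝ) = (2 : ℝ) ^ M) {η : ℝ} (hη : 0 < η) {D : ℕ} (hD : D ≤ B * Nt) :
    ∃ c : ℝ, 0 < c ∧ ∀ x : ℝ, 1 ≤ x → ∀ p : ℝ, 0 ≤ p → p ≤ x →
      c * (x ^ (Nr * D))⁻¹ ≤ (roundLaw B Nr Nt).real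
        {h | roundInfo 𝒳 p h ≤ ((B : ℝ) * Nt - D) * (M / B) + η} := by
  classical
  obtain ⟨ρ, hρ, hMI⟩ := exists_mutualInfo_le (𝒳 := 𝒳) Nr Nt hM hη
  obtain ⟨c, hc, hball⟩ := exists_le_stdComplexGaussian_closedBall
  -- Any `D` pairs of a block and a transmit antenna will do; all gains from these antennas are made
  -- small.
  obtain ⟨T, -, hT⟩ : ∃ T ⊆ (Finset.univ : Finset (Fin B × Fin Nt)), T.card = D :=
    Finset.exists_subset_card_eq (by simpa using hD)
  set ρ' := min ρ 1
  have hρ' : 0 < ρ' := lt_min hρ one_pos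
  have hB' : (0 : ℝ) < B := by exact_mod_cast hB
  have hNt' : (1 : ℝ) ≤ Nt := by exact_mod_cast hNt
  refine ⟨(c * ρ' ^ 2) ^ (Nr * D), by positivity, fun x hx p hp0 hpx => ?_⟩
  have hx0 : 0 < x := by linarith
  have hsx : 1 ≤ √x := Real.one_le_sqrt.2 hx
  -- At power at most `x`, fading gains of size `s` become channel gains of size at most `ρ`.
  -- Capping at `ρ' ≤ 1` keeps `s` in the range of the small-ball bound.
  set s := ρ' / √x with hs
  have hs0 : 0 ≤ s := by positivity
  have hs1 : s ≤ 1 := (div_le_one (by positivity)).2 ((min_le_right _ _).trans hsx)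
  let Sb : Fin B → Fin Nt → Set ℂ := fun b t =>
    if (b, t) ∈ T then Metric.closedBall 0 s else Set.univ
  let E : Set (RoundGain B Nr Nt) :=
    Set.univ.pi fun b => Set.univ.pi fun _ => Set.univ.pi fun t => Sb b t
  have hcardT : ∑ b : Fin B, (Finset.univ.filter fun t => (b, t) ∈ T).card = D := by
    rw [← hT, Finset.card_eq_sum_card_fiberwise (f := Prod.fst) (t := Finset.univ) (by simp)]
    refine Finset.sum_congr rfl fun b _ => ?_
    refine Finset.card_bij (fun t _ => (b, t)) ?_ ?_ ?_
    · intro t ht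
      simpa using ht
    · intro t _ t' _ h
      exact (Prod.mk.inj h).2
    · rintro ⟨b', t⟩ h
      simp only [Finset.mem_filter] at h
      obtain ⟨h1, rfl⟩ := h
      exact ⟨t, by simpa using h1, rfl⟩
  have hsub : E ⊆ {h | roundInfo 𝒳 p h ≤ ((B : ℝ) * Nt - D) * (M / B) + η} := by
    intro h hh
    have hent : ∀ b r t, h b r t ∈ Sb b t := fun b r t =>
      hh b (Set.mem_univ _) r (Set.mem_univ _) t (Set.mem_univ _)
    have hb : ∀ b, mutualInfo 𝒳 (gainMatrix p (h b)) ≤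
        ((Nt : ℝ) - (Finset.univ.filter fun t => (b, t) ∈ T).card) * M + η := by
      intro b
      refine hMI _ _ fun r t ht => ?_
      have h1 := hent b r t
      simp only [Finset.mem_filter, Finset.mem_univ, true_and] at ht
      simp only [Sb, if_pos ht, Metric.mem_closedBall, dist_zero_right] at h1
      simp only [gainMatrix, Matrix.smul_apply, Matrix.of_apply, smul_eq_mul, norm_mul,
        Complex.norm_real, Real.norm_of_nonneg (Real.sqrt_nonneg _)]
      calc √(p / Nt) * ‖h b r t‖ ≤ √x * s := by
            gcongr
            exact (div_le_self hp0 hNt').trans hpx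
        _ = ρ' := by rw [hs]; field_simp
        _ ≤ ρ := min_le_left _ _
    have hsum := Finset.sum_le_sum fun b (_ : b ∈ Finset.univ) => hb b
    rw [Finset.sum_add_distrib, ← Finset.sum_mul, Finset.sum_sub_distrib,
      ← Nat.cast_sum Finset.univ fun b : Fin B => (Finset.univ.filter fun t => (b, t) ∈ T).card,
      hcardT] at hsum
    simp only [Finset.sum_const, Finset.card_univ, Fintype.card_fin, nsmul_eq_mul] at hsum
    have : roundInfo 𝒳 p h = (B : ℝ)⁻¹ * ∑ b, mutualInfo 𝒳 (gainMatrix p (h b)) := rfl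
    rw [Set.mem_ofPred_eq, this, inv_mul_le_iff₀ hB']
    refine hsum.trans (le_of_eq ?_)
    field_simp
  have hE : ENNReal.ofReal ((c * ρ' ^ 2) ^ (Nr * D) * (x ^ (Nr * D))⁻¹) ≤ roundLaw B Nr Nt E := by
    have hval : roundLaw B Nr Nt E =
        stdComplexGaussian (Metric.closedBall 0 s) ^ (Nr * D) := by
      have hSb : ∀ b t, stdComplexGaussian (Sb b t) =
          if (b, t) ∈ T then stdComplexGaussian (Metric.closedBall 0 s) else 1 := by
        intro b t
        simp only [Sb]
        split_ifs
        · rfl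
        · exact measure_univ
      simp only [roundLaw, E, Measure.pi_pi, hSb, Finset.prod_ite, Finset.prod_const,
        Finset.card_univ, Fintype.card_fin, one_pow, mul_one]
      rw [Finset.prod_pow, Finset.prod_pow_eq_pow_sum, hcardT, ← pow_mul, mul_comm]
    rw [hval]
    have h2 : (c * ρ' ^ 2) ^ (Nr * D) * (x ^ (Nr * D))⁻¹ = (c * s ^ 2) ^ (Nr * D) := by
      rw [hs, div_pow, Real.sq_sqrt hx0.le, ← inv_pow, ← mul_pow]
      congr 1
      rw [mul_assoc, div_eq_mul_inv]
    rw [h2, ENNReal.ofReal_pow (by positivity)]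
    gcongr
    exact hball s hs0 hs1
  have := (hE.trans (measure_mono hsub))
  rw [measureReal_def]
  exact (ENNReal.ofReal_le_iff_le_toReal (measure_ne_top _ _)).1 this

/-! ## Measurability and independence of the rounds -/

lemma roundInfo_nonneg {𝒳 : Finset ℂ} (h0 : 0 < 𝒳.card) {B Nr Nt : ℕ} (p : ℝ)
    (h : RoundGain B Nr Nt) : 0 ≤ roundInfo 𝒳 p h :=
  mul_nonneg (by positivity) (Finset.sum_nonneg fun _ _ => mutualInfo_nonneg _ h0)

lemma measurable_roundInfo (𝒳 : Finset ℂ) {B Nr Nt : ℕ} (p : ℝ) :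
    Measurable fun h : RoundGain B Nr Nt => roundInfo 𝒳 p h := by
  unfold roundInfo
  refine (Finset.measurable_sum _ fun b _ => measurable_mutualInfo 𝒳 fun r t => ?_).const_mul _
  simp only [Matrix.smul_apply, Matrix.of_apply]
  fun_prop

/-- Powers and thresholds depend on the past only through the feedback, which takes finitely many
values, so no joint measurability in the power is needed. -/
lemma measurable_comp_of_countable {α β γ δ : Type*} [MeasurableSpace α] [MeasurableSpace β]
    [MeasurableSpace γ] [MeasurableSpace δ] [Countable β] [MeasurableSingletonClass β]
    (f : β → γ → δ) (hf : ∀ b, Measurable (f b)) {u : α → β} {v : α → γ} (hu : Measurable u)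
    (hv : Measurable v) : Measurable fun a => f (u a) (v a) := by
  have h : Measurable (Function.uncurry f) := measurable_from_prod_countable_right hf
  exact h.comp (hu.prodMk hv)

section System

variable {𝒳 : Finset ℂ} {B Nr Nt K : ℕ} [NeZero K] {R : ℝ} {Q : Quantizer K} {S : PowerRule K}

lemma accInfo_zero (h : ℕ → RoundGain B Nr Nt) : accInfo 𝒳 R Q S h 0 = 0 := rfl

lemma accInfo_succ (h : ℕ → RoundGain B Nr Nt) (n : ℕ) : accInfo 𝒳 R Q S h (n + 1) =
    accInfo 𝒳 R Q S h n + roundInfo 𝒳 (S.power n (feedback 𝒳 R Q S h n)) (h n) := rfl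

lemma feedback_succ (h : ℕ → RoundGain B Nr Nt) (n : ℕ) : feedback 𝒳 R Q S h (n + 1) =
    Fin.snoc (α := fun _ => Fin K) (feedback 𝒳 R Q S h n)
      (feedbackIndex Q R (feedback 𝒳 R Q S h n) (accInfo 𝒳 R Q S h (n + 1))) := rfl

lemma state_congr {h h' : ℕ → RoundGain B Nr Nt} {n : ℕ} (hh : ∀ i < n, h i = h' i) :
    state 𝒳 R Q S h n = state 𝒳 R Q S h' n := by
  induction n with
  | zero => rfl
  | succ n ih =>
    have := ih fun i hi => hh i (by omega)
    simp only [state, this, hh n (by omega)]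

lemma measurable_feedbackIndex {n : ℕ} (fb : Fin n → Fin K) :
    Measurable fun a : ℝ => feedbackIndex Q R fb a := by
  classical
  unfold feedbackIndex
  refine Measurable.ite measurableSet_Ici measurable_const ?_
  refine measurable_to_countable' fun k => ?_
  have : Measurable fun a : ℝ => Nat.findGreatest (fun k => Q.thr n fb k ≤ a) (K - 2) :=
    measurable_findGreatest fun k _ => measurableSet_Ici
  convert this (measurableSet_singleton (k : ℕ)) using 1
  ext a
  simp [Fin.ext_iff]

lemma measurable_state (n : ℕ) :
    Measurable fun h : ℕ → RoundGain B Nr Nt => state 𝒳 R Q S h n := by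
  induction n with
  | zero => exact measurable_const
  | succ n ih =>
    have h1 : Measurable fun h : ℕ → RoundGain B Nr Nt => (state 𝒳 R Q S h n).1 := ih.fst
    have h2 : Measurable fun h : ℕ → RoundGain B Nr Nt => (state 𝒳 R Q S h n).2 := ih.snd
    have h3 : Measurable fun h : ℕ → RoundGain B Nr Nt => h n := measurable_pi_apply n
    have h4 := measurable_comp_of_countable (fun fb g => roundInfo 𝒳 (S.power n fb) g)
      (fun fb => measurable_roundInfo 𝒳 (S.power n fb)) h1 h3
    have ha : Measurable fun h : ℕ → RoundGain B Nr Nt => (state 𝒳 R Q S h n).2 +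
      roundInfo 𝒳 (S.power n (state 𝒳 R Q S h n).1) (h n) := h2.add h4
    have hi := measurable_comp_of_countable (fun fb a => feedbackIndex Q R fb a)
      (fun fb => measurable_feedbackIndex fb) h1 ha
    have hs := measurable_comp_of_countable
      (fun (fb : Fin n → Fin K) k => (Fin.snoc (α := fun _ => Fin K) fb k : Fin (n + 1) → Fin K))
      (fun fb => Measurable.of_discrete) h1 hi
    exact hs.prodMk ha

lemma measurable_feedback (n : ℕ) :
    Measurable fun h : ℕ → RoundGain B Nr Nt => feedback 𝒳 R Q S h n := (measurable_state n).fst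

lemma measurable_accInfo (n : ℕ) :
    Measurable fun h : ℕ → RoundGain B Nr Nt => accInfo 𝒳 R Q S h n := (measurable_state n).snd

lemma feedback_congr {h h' : ℕ → RoundGain B Nr Nt} {n : ℕ} (hh : ∀ i < n, h i = h' i) :
    feedback 𝒳 R Q S h n = feedback 𝒳 R Q S h' n := by
  rw [feedback, feedback, state_congr hh]

lemma accInfo_congr {h h' : ℕ → RoundGain B Nr Nt} {n : ℕ} (hh : ∀ i < n, h i = h' i) :
    accInfo 𝒳 R Q S h n = accInfo 𝒳 R Q S h' n := by
  rw [accInfo, accInfo, state_congr hh]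

end System

instance (B Nr Nt : ℕ) : IsProbabilityMeasure (fadingLaw B Nr Nt) := by
  unfold fadingLaw; infer_instance

/-- An event about the first `n` rounds is independent of the gains of the next round. -/
lemma fadingLaw_inter_eq_mul {B Nr Nt n : ℕ} {E : Set (ℕ → RoundGain B Nr Nt)}
    (hE : MeasurableSet E) (hE' : ∀ h h', (∀ i < n, h i = h' i) → h ∈ E → h' ∈ E)
    {T : Set (RoundGain B Nr Nt)} (hT : MeasurableSet T) :
    (fadingLaw B Nr Nt).real (E ∩ {h | h n ∈ T}) =
      (fadingLaw B Nr Nt).real E * (roundLaw B Nr Nt).real T := by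
  have hind : iIndepFun (fun (i : ℕ) (ω : ℕ → RoundGain B Nr Nt) => ω i) (fadingLaw B Nr Nt) :=
    iIndepFun_infinitePi (X := fun _ x => x) fun _ => measurable_id
  have h2 := hind.indepFun_finset (Finset.range n) {n} (by simp) (fun i => measurable_pi_apply i)
  -- Padding the first `n` rounds by zeros presents `E` as a preimage under those coordinates, as
  -- the independence statement requires.
  let ext : ((i : Finset.range n) → RoundGain B Nr Nt) → ℕ → RoundGain B Nr Nt :=
    fun g i => if hi : i ∈ Finset.range n then g ⟨i, hi⟩ else 0
  have hext : Measurable ext := by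
    refine measurable_pi_lambda _ fun i => ?_
    by_cases hi : i ∈ Finset.range n
    · simp only [ext, hi, dite_true]
      exact measurable_pi_apply _
    · simp only [ext, hi, dite_false]
      exact measurable_const
  have hpre : (fun (a : ℕ → RoundGain B Nr Nt) (i : Finset.range n) => a i) ⁻¹' (ext ⁻¹' E) =
      E := by
    ext a
    have ha : ∀ i < n, a i = ext (fun j : Finset.range n => a j) i := fun i hi => by
      simp [ext, hi]
    exact ⟨hE' _ _ fun i hi => (ha i hi).symm, hE' _ _ ha⟩
  have hmul := h2.measure_inter_preimage_eq_mul _ {g | g ⟨n, by simp⟩ ∈ T} (hext hE)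
    (measurable_pi_apply (⟨n, by simp⟩ : ({n} : Finset ℕ)) hT)
  rw [hpre] at hmul
  have hmarg : fadingLaw B Nr Nt {h | h n ∈ T} = roundLaw B Nr Nt T :=
    (measurePreserving_eval_infinitePi (fun _ => roundLaw B Nr Nt) n).measure_preimage
      hT.nullMeasurableSet
  have h3 : (fun (a : ℕ → RoundGain B Nr Nt) (i : ({n} : Finset ℕ)) => a i) ⁻¹'
      {g | g ⟨n, by simp⟩ ∈ T} = {h | h n ∈ T} := rfl
  rw [h3, hmarg] at hmul
  rw [measureReal_def, hmul, ENNReal.toReal_mul]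
  rfl

/-! ## Converse: a lower bound on the outage probability of every system -/

section Converse

variable {𝒳 : Finset ℂ} {B Nr Nt K L : ℕ} [NeZero K] {R : ℝ} {Q : Quantizer K}
  {S : PowerRule K}

lemma feedbackProb_mul_power_le {P : ℝ} (hP : averagePower 𝒳 B Nr Nt R Q S L ≤ P) {n : ℕ}
    (hn : n < L) (fb : Fin n → Fin K) :
    feedbackProb 𝒳 B Nr Nt R Q S fb * S.power n fb ≤ P := by
  have h0 : ∀ (n : ℕ) (fb : Fin n → Fin K),
      0 ≤ feedbackProb 𝒳 B Nr Nt R Q S fb * S.power n fb :=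
    fun n fb => mul_nonneg measureReal_nonneg (S.power_nonneg n fb)
  calc _ ≤ ∑ fb : Fin n → Fin K, feedbackProb 𝒳 B Nr Nt R Q S fb * S.power n fb :=
        Finset.single_le_sum (f := fun fb : Fin n → Fin K =>
          feedbackProb 𝒳 B Nr Nt R Q S fb * S.power n fb) (fun fb _ => h0 n fb)
          (Finset.mem_univ fb)
    _ ≤ averagePower 𝒳 B Nr Nt R Q S L :=
        Finset.single_le_sum (f := fun n => ∑ fb : Fin n → Fin K,
          feedbackProb 𝒳 B Nr Nt R Q S fb * S.power n fb)
          (fun n _ => Finset.sum_nonneg fun fb _ => h0 n fb) (Finset.mem_range.2 hn)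
    _ ≤ P := hP

/-- The event that the feedback after `n` rounds is `fb` and the information is at most `a`. -/
def lowInfoEvent (𝒳 : Finset ℂ) (B Nr Nt : ℕ) (R : ℝ) (Q : Quantizer K) (S : PowerRule K) {n : ℕ}
    (fb : Fin n → Fin K) (a : ℝ) : Set (ℕ → RoundGain B Nr Nt) :=
  {h | feedback 𝒳 R Q S h n = fb ∧ accInfo 𝒳 R Q S h n ≤ a}

lemma measurableSet_lowInfoEvent {n : ℕ} (fb : Fin n → Fin K) (a : ℝ) :
    MeasurableSet (lowInfoEvent 𝒳 B Nr Nt R Q S fb a) :=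
  (measurable_feedback n (measurableSet_singleton fb)).inter
    (measurable_accInfo n measurableSet_Iic)

lemma lowInfoEvent_congr {n : ℕ} (fb : Fin n → Fin K) (a : ℝ) (h h' : ℕ → RoundGain B Nr Nt)
    (hh : ∀ i < n, h i = h' i) (hmem : h ∈ lowInfoEvent 𝒳 B Nr Nt R Q S fb a) :
    h' ∈ lowInfoEvent 𝒳 B Nr Nt R Q S fb a := by
  rw [lowInfoEvent, Set.mem_ofPred_eq] at hmem ⊢
  rwa [← feedback_congr hh, ← accInfo_congr hh]

/-- The feedback `fb` is at least as likely as the event, and its share of the average power is at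
most `P`. -/
lemma power_le_div {P : ℝ} (hP : averagePower 𝒳 B Nr Nt R Q S L ≤ P) {n : ℕ} (hn : n < L)
    (fb : Fin n → Fin K) {a : ℝ}
    (hr : 0 < (fadingLaw B Nr Nt).real (lowInfoEvent 𝒳 B Nr Nt R Q S fb a)) :
    S.power n fb ≤ P / (fadingLaw B Nr Nt).real (lowInfoEvent 𝒳 B Nr Nt R Q S fb a) := by
  rw [le_div_iff₀ hr, mul_comm]
  refine le_trans ?_ (feedbackProb_mul_power_le hP hn fb)
  gcongr
  · exact S.power_nonneg n fb
  · exact measureReal_mono fun h hh => hh.1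

/-- Whatever the system, some feedback vector is combined with almost no information with a
probability that is not too small. -/
lemma exists_lowInfoEvent (hB : 0 < B) (hNt : 0 < Nt) {M : ℝ}
    (hM : (𝒳.card : ℝ) = (2 : ℝ) ^ M) (R : ℝ) (K : ℕ) [NeZero K] {η : ℝ} (hη : 0 < η) (n : ℕ) :
    ∃ A : ℝ, 0 < A ∧ ∀ (L : ℕ) (P : ℝ) (Q : Quantizer K) (S : PowerRule K), n < L → 1 ≤ P →
      averagePower 𝒳 B Nr Nt R Q S L ≤ P → ∃ fb : Fin n → Fin K,
        0 < (fadingLaw B Nr Nt).real (lowInfoEvent 𝒳 B Nr Nt R Q S fb (n * η)) ∧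
        P / (fadingLaw B Nr Nt).real (lowInfoEvent 𝒳 B Nr Nt R Q S fb (n * η)) ≤
          A * P ^ ((1 + Nr * (B * Nt)) ^ n) := by
  induction n with
  | zero =>
    refine ⟨1, one_pos, fun L P Q S _ _ _ => ⟨Fin.elim0, ?_⟩⟩
    have : lowInfoEvent 𝒳 B Nr Nt R Q S (Fin.elim0 : Fin 0 → Fin K) ((0 : ℕ) * η) = Set.univ := by
      ext h
      simp [lowInfoEvent, accInfo_zero, eq_iff_true_of_subsingleton]
    rw [this]
    simp
  | succ n ih =>
    obtain ⟨A, hA, ih⟩ := ih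
    obtain ⟨c, hc, hround⟩ := exists_le_roundLaw_roundInfo_le (Nr := Nr) hB hNt hM hη
      (le_refl (B * Nt))
    have hK : (0 : ℝ) < K := by exact_mod_cast NeZero.pos K
    refine ⟨K / c * A ^ (1 + Nr * (B * Nt)), by positivity, fun L P Q S hn hP hav => ?_⟩
    obtain ⟨fb, hr, hx⟩ := ih L P Q S (by omega) hP hav
    have hpow := power_le_div hav (by omega) fb hr
    set E := lowInfoEvent 𝒳 B Nr Nt R Q S fb (n * η) with hEdef
    set r := (fadingLaw B Nr Nt).real E
    have hr1 : r ≤ 1 := measureReal_le_one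
    have hx1 : 1 ≤ P / r := (one_le_div hr).2 (hr1.trans hP)
    have hT := hround _ hx1 _ (S.power_nonneg n fb) hpow
    set T : Set (RoundGain B Nr Nt) := {h | roundInfo 𝒳 (S.power n fb) h ≤
      ((B : ℝ) * Nt - (B * Nt : ℕ)) * (M / B) + η} with hTdef
    have hTm : MeasurableSet T := measurable_roundInfo 𝒳 _ measurableSet_Iic
    have hind := fadingLaw_inter_eq_mul (E := E) (measurableSet_lowInfoEvent fb (n * η))
      (lowInfoEvent_congr fb (n * η)) hTm
    have hsub : E ∩ {h | h n ∈ T} ⊆ ⋃ k : Fin K, lowInfoEvent 𝒳 B Nr Nt R Q S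
        (Fin.snoc (α := fun _ => Fin K) fb k) ((n + 1 : ℕ) * η) := by
      rintro h ⟨⟨h1, h2⟩, h3⟩
      rw [Set.mem_iUnion]
      refine ⟨feedbackIndex Q R fb (accInfo 𝒳 R Q S h (n + 1)), ?_, ?_⟩
      · rw [feedback_succ, h1]
      · have h4 : roundInfo 𝒳 (S.power n fb) (h n) ≤
            ((B : ℝ) * Nt - (B * Nt : ℕ)) * (M / B) + η := h3
        rw [accInfo_succ, h1]
        push_cast at h4 ⊢
        rw [sub_self, zero_mul, zero_add] at h4
        linarith
    have hsum : c * ((P / r) ^ (Nr * (B * Nt)))⁻¹ * r ≤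
        ∑ k : Fin K, (fadingLaw B Nr Nt).real (lowInfoEvent 𝒳 B Nr Nt R Q S
          (Fin.snoc (α := fun _ => Fin K) fb k) ((n + 1 : ℕ) * η)) := by
      calc _ ≤ (fadingLaw B Nr Nt).real (E ∩ {h | h n ∈ T}) := by
            rw [hind, mul_comm]
            gcongr
        _ ≤ _ := (measureReal_mono hsub).trans (measureReal_iUnion_fintype_le _)
    -- Pigeonhole: one of the `K` possible next indices carries at least the average probability.
    obtain ⟨k, -, hk⟩ := Finset.exists_le_of_sum_le (s := (Finset.univ : Finset (Fin K)))
      (f := fun _ => c * ((P / r) ^ (Nr * (B * Nt)))⁻¹ * r / K) ⟨0, Finset.mem_univ _⟩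
      (le_trans (le_of_eq (by simp; field_simp)) hsum)
    have hP0 : 0 < P := by linarith
    have hlow : 0 < c * ((P / r) ^ (Nr * (B * Nt)))⁻¹ * r / K := by positivity
    refine ⟨Fin.snoc (α := fun _ => Fin K) fb k, hlow.trans_le hk, ?_⟩
    calc _ ≤ P / (c * ((P / r) ^ (Nr * (B * Nt)))⁻¹ * r / K) := by gcongr
      _ = K / c * (P / r) ^ (1 + Nr * (B * Nt)) := by
          rw [pow_add, pow_one]
          field_simp
      _ ≤ K / c * (A * P ^ ((1 + Nr * (B * Nt)) ^ n)) ^ (1 + Nr * (B * Nt)) := by gcongr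
      _ = _ := by rw [mul_pow, ← pow_mul, ← pow_succ, mul_assoc]

/-- The converse: no system has a larger outage diversity. -/
lemma exists_le_outageProb (hB : 0 < B) (hNt : 0 < Nt) {M : ℝ}
    (hM : (𝒳.card : ℝ) = (2 : ℝ) ^ M) (R : ℝ) (K : ℕ) [NeZero K] {J : ℕ}
    (hJ : J ≤ B * Nt) (hJR : J * (M / B) < R) (n : ℕ) :
    ∃ c : ℝ, 0 < c ∧ ∀ (L : ℕ) (P : ℝ) (Q : Quantizer K) (S : PowerRule K), n < L → 1 ≤ P →
      averagePower 𝒳 B Nr Nt R Q S L ≤ P →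
      c * P * (P ^ ((1 + Nr * (B * Nt)) ^ n * (1 + Nr * (B * Nt - J))))⁻¹ ≤
        outageProb 𝒳 B Nr Nt R Q S (n + 1) := by
  -- Each of the `n + 1` rounds may leak `η`; the divisor `n + 2` keeps the total strictly below
  -- `R`.
  set η : ℝ := (R - J * (M / B)) / (n + 2) with hη
  have hη0 : 0 < η := div_pos (by linarith) (by positivity)
  have hηR : J * (M / B) + (n + 1) * η < R := by
    have : (n + 2) * η = R - J * (M / B) := by rw [hη]; field_simp
    linarith
  obtain ⟨A, hA, hlow⟩ := exists_lowInfoEvent (𝒳 := 𝒳) (Nr := Nr) hB hNt hM R K hη0 n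
  obtain ⟨c, hc, hround⟩ := exists_le_roundLaw_roundInfo_le (Nr := Nr) (D := B * Nt - J) hB hNt hM
    hη0 (Nat.sub_le _ _)
  refine ⟨c * (A ^ (1 + Nr * (B * Nt - J)))⁻¹, by positivity, fun L P Q S hn hP hav => ?_⟩
  obtain ⟨fb, hr, hx⟩ := hlow L P Q S hn hP hav
  have hpow := power_le_div hav hn fb hr
  set E := lowInfoEvent 𝒳 B Nr Nt R Q S fb (n * η) with hEdef
  set r := (fadingLaw B Nr Nt).real E
  have hr1 : r ≤ 1 := measureReal_le_one
  have hx1 : 1 ≤ P / r := (one_le_div hr).2 (hr1.trans hP)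
  have hT := hround _ hx1 _ (S.power_nonneg n fb) hpow
  set T : Set (RoundGain B Nr Nt) := {h | roundInfo 𝒳 (S.power n fb) h ≤
    ((B : ℝ) * Nt - (B * Nt - J : ℕ)) * (M / B) + η} with hTdef
  have hTm : MeasurableSet T := measurable_roundInfo 𝒳 _ measurableSet_Iic
  have hind := fadingLaw_inter_eq_mul (E := E) (measurableSet_lowInfoEvent fb (n * η))
    (lowInfoEvent_congr fb (n * η)) hTm
  have hsub : E ∩ {h | h n ∈ T} ⊆ {h | accInfo 𝒳 R Q S h (n + 1) < R} := by
    rintro h ⟨⟨h1, h2⟩, h3⟩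
    have h4 : roundInfo 𝒳 (S.power n fb) (h n) ≤
        ((B : ℝ) * Nt - (B * Nt - J : ℕ)) * (M / B) + η := h3
    rw [Nat.cast_sub hJ, Nat.cast_mul, sub_sub_cancel] at h4
    rw [Set.mem_ofPred_eq, accInfo_succ, h1]
    linarith
  have hP0 : 0 < P := by linarith
  have hx0 : 0 < P / r := by positivity
  calc _ = c * P * ((A * P ^ ((1 + Nr * (B * Nt)) ^ n)) ^ (1 + Nr * (B * Nt - J)))⁻¹ := by
        rw [mul_pow, ← pow_mul, mul_inv]
        ring
    _ ≤ c * P * ((P / r) ^ (1 + Nr * (B * Nt - J)))⁻¹ := by gcongr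
    _ = r * (c * ((P / r) ^ (Nr * (B * Nt - J)))⁻¹) := by
        rw [pow_add, pow_one]
        field_simp
    _ ≤ (fadingLaw B Nr Nt).real (E ∩ {h | h n ∈ T}) := by
        rw [hind]
        gcongr
    _ ≤ _ := measureReal_mono hsub

end Converse

/-! ## Achievability: thresholds just below the multiples of `M / B` -/

/-- Sum of the feedback indices. -/
def fbSum {K n : ℕ} (fb : Fin n → Fin K) : ℕ := ∑ i, (fb i : ℕ)

/-- Thresholds at the multiples of `u`, lowered by `d n` in round `n`. -/
def gridThr (K : ℕ) (u : ℝ) (d : ℕ → ℝ) : (n : ℕ) → (Fin n → Fin K) → ℕ → ℝ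
  | 0, _, k => if k = 0 then 0 else k * u - d 0
  | n + 1, fb, k =>
    if k = 0 then gridThr K u d n (Fin.init fb) (fb (Fin.last n))
    else ((fbSum fb + k : ℕ) : ℝ) * u - d (n + 1)

section Grid

variable {K : ℕ} {u : ℝ} {d : ℕ → ℝ}

lemma gridThr_of_ne_zero {n : ℕ} (fb : Fin n → Fin K) {k : ℕ} (hk : k ≠ 0) :
    gridThr K u d n fb k = ((fbSum fb + k : ℕ) : ℝ) * u - d n := by
  cases n with
  | zero => simp [gridThr, hk, fbSum]
  | succ n => simp [gridThr, hk]

lemma gridThr_snoc {n : ℕ} (fb : Fin n → Fin K) (k : Fin K) :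
    gridThr K u d (n + 1) (Fin.snoc (α := fun _ => Fin K) fb k) 0 = gridThr K u d n fb k := by
  simp [gridThr]

lemma fbSum_init {n : ℕ} (fb : Fin (n + 1) → Fin K) :
    fbSum (Fin.init fb : Fin n → Fin K) + fb (Fin.last n) = fbSum fb := by
  simp [fbSum, Fin.sum_univ_castSucc, Fin.init]

lemma gridThr_le (hd : ∀ n, 0 ≤ d n) {n : ℕ} (fb : Fin n → Fin K) (k : ℕ) :
    gridThr K u d n fb k ≤ ((fbSum fb + k : ℕ) : ℝ) * u := by
  by_cases hk : k = 0
  · subst hk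
    induction n with
    | zero => simp [gridThr, fbSum]
    | succ n ih =>
      simp only [gridThr, if_true]
      by_cases h0 : (fb (Fin.last n) : ℕ) = 0
      · have := ih (Fin.init fb)
        rw [h0]
        rwa [← fbSum_init fb, h0]
      · rw [gridThr_of_ne_zero _ h0, fbSum_init]
        have := hd n
        simp only [add_zero]
        linarith
  · rw [gridThr_of_ne_zero fb hk]
    linarith [hd n]

/-- The threshold at index `0` is inherited from an earlier round, where it was lowered by at least
`δ` less than the current thresholds. This gap is the slack `δ` that the one-round outage bound
requires. -/
lemma le_gridThr_zero {δ : ℝ} {L : ℕ} (hd0 : d 0 = δ) (hδ : 0 ≤ δ)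
    (hstep : ∀ n < L, d n + δ ≤ d (n + 1)) {n : ℕ} (hn : n ≤ L) (fb : Fin n → Fin K) :
    (fbSum fb : ℝ) * u - (d n - δ) ≤ gridThr K u d n fb 0 := by
  induction n with
  | zero => simp [gridThr, fbSum, hd0]
  | succ n ih =>
    have h1 := hstep n (by omega)
    simp only [gridThr, if_true]
    by_cases h0 : (fb (Fin.last n) : ℕ) = 0
    · have := ih (by omega) (Fin.init fb)
      rw [h0, ← fbSum_init fb, h0, add_zero]
      linarith
    · rw [gridThr_of_ne_zero _ h0, fbSum_init]
      linarith

variable (K u d) in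
/-- The quantizer with thresholds `gridThr`. -/
def gridQuantizer (hd : ∀ n, 0 ≤ d n) (hdu : ∀ n, d n < u) : Quantizer K where
  thr := gridThr K u d
  thr_first _ := by simp [gridThr]
  thr_snoc _ fb k _ := gridThr_snoc fb k
  thr_lt n fb k _ := by
    rw [gridThr_of_ne_zero fb k.succ_ne_zero]
    have hu : 0 < u := (hd 0).trans_lt (hdu 0)
    by_cases hk : k = 0
    · have h1 := gridThr_le (u := u) hd fb k
      have h2 := hdu n
      push_cast at h1 ⊢
      linarith
    · rw [gridThr_of_ne_zero fb hk]
      push_cast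
      linarith

end Grid

/-- The product of the factors `1 + r (N - k_i)`, the exponent of the power that follows the
feedback `fb`. -/
def fbExp (r N : ℕ) {K n : ℕ} (fb : Fin n → Fin K) : ℕ := ∏ i, (1 + r * (N - fb i))

lemma fbExp_snoc (r N : ℕ) {K n : ℕ} (fb : Fin n → Fin K) (k : Fin K) :
    fbExp r N (Fin.snoc (α := fun _ => Fin K) fb k : Fin (n + 1) → Fin K) =
      fbExp r N fb * (1 + r * (N - k)) := by
  simp [fbExp, Fin.prod_univ_castSucc]

lemma fbExp_init (r N : ℕ) {K n : ℕ} (fb : Fin (n + 1) → Fin K) :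
    fbExp r N (Fin.init fb : Fin n → Fin K) * (1 + r * (N - fb (Fin.last n))) =
      fbExp r N fb := by
  simp [fbExp, Fin.prod_univ_castSucc, Fin.init]

/-- The two sides have factors with equal sums, and the product grows as factors approach each
other; the difference is `r ^ 2 * k * (J - k)`. -/
lemma one_add_mul_le_mul (r : ℕ) {N J k : ℕ} (hJ : J ≤ N) (hk : k ≤ J) :
    (1 + r * N) * (1 + r * (N - J)) ≤ (1 + r * (N - (J - k))) * (1 + r * (N - k)) := by
  obtain ⟨t, rfl⟩ := Nat.exists_eq_add_of_le hk
  obtain ⟨s, rfl⟩ := Nat.exists_eq_add_of_le hJ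
  have h1 : k + t + s - (k + t) = s := by omega
  have h2 : k + t + s - (k + t - k) = k + s := by omega
  have h3 : k + t + s - k = t + s := by omega
  rw [h1, h2, h3]
  nlinarith [Nat.zero_le (r * r * (t * k))]

/-- Spreading the accumulated information over several rounds does not help. -/
lemma pow_mul_le_fbExp_mul (r : ℕ) {N J K n : ℕ} (hJ : J ≤ N) (fb : Fin n → Fin K)
    (hfb : fbSum fb ≤ J) :
    (1 + r * N) ^ n * (1 + r * (N - J)) ≤ fbExp r N fb * (1 + r * (N - (J - fbSum fb))) := by
  induction n generalizing J with
  | zero => simp [fbExp, fbSum]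
  | succ n ih =>
    have hs := fbSum_init fb
    have h1 := ih (J := J - fb (Fin.last n)) (by omega) (Fin.init fb) (by omega)
    have h2 := one_add_mul_le_mul r hJ (k := fb (Fin.last n)) (by omega)
    have h3 : J - (fb (Fin.last n) : ℕ) - fbSum (Fin.init fb : Fin n → Fin K) = J - fbSum fb := by
      omega
    rw [h3] at h1
    rw [← fbExp_init]
    calc (1 + r * N) ^ (n + 1) * (1 + r * (N - J))
        = (1 + r * N) ^ n * ((1 + r * N) * (1 + r * (N - J))) := by ring
      _ ≤ (1 + r * N) ^ n * ((1 + r * (N - (J - fb (Fin.last n)))) *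
          (1 + r * (N - fb (Fin.last n)))) := Nat.mul_le_mul_left _ h2
      _ = (1 + r * N) ^ n * (1 + r * (N - (J - fb (Fin.last n)))) *
          (1 + r * (N - fb (Fin.last n))) := by ring
      _ ≤ fbExp r N (Fin.init fb : Fin n → Fin K) * (1 + r * (N - (J - fbSum fb))) *
          (1 + r * (N - fb (Fin.last n))) := Nat.mul_le_mul_right _ h1
      _ = _ := by ring

open Classical in
/-- Power `x ^ fbExp` after feedback without acknowledgment. -/
def expPowerRule (r N K : ℕ) [NeZero K] (x : ℝ) : PowerRule K where
  -- The absolute value makes the rule nonnegative for every `x`; it is only used for `x > 0`.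
  power _ fb := if ∃ i, fb i = ack K then 0 else |x| ^ fbExp r N fb
  power_nonneg _ fb := by
    split_ifs
    · exact le_rfl
    · positivity
  power_ack _ fb h := if_pos h

/-! ### Invariants relating the feedback to the accumulated information -/

section Dynamics

variable {𝒳 : Finset ℂ} {B Nr Nt K L : ℕ} [NeZero K] {R : ℝ} {Q : Quantizer K} {S : PowerRule K}

lemma accInfo_mono (h0 : 0 < 𝒳.card) (h : ℕ → RoundGain B Nr Nt) (n : ℕ) :
    accInfo 𝒳 R Q S h n ≤ accInfo 𝒳 R Q S h (n + 1) := by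
  rw [accInfo_succ]
  linarith [roundInfo_nonneg h0 (S.power n (feedback 𝒳 R Q S h n)) (h n)]

open Classical in
lemma feedbackIndex_val_of_lt {n : ℕ} (fb : Fin n → Fin K) {a : ℝ} (ha : a < R) :
    (feedbackIndex Q R fb a : ℕ) = Nat.findGreatest (fun k => Q.thr n fb k ≤ a) (K - 2) := by
  rw [feedbackIndex, if_neg (not_le.2 ha)]

lemma feedbackIndex_val_le {n : ℕ} (fb : Fin n → Fin K) {a : ℝ} (ha : a < R) :
    (feedbackIndex Q R fb a : ℕ) ≤ K - 2 := by
  classical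
  rw [feedbackIndex_val_of_lt fb ha]
  exact Nat.findGreatest_le _

lemma feedback_ne_ack (h0 : 0 < 𝒳.card) (hK : 2 ≤ K) (h : ℕ → RoundGain B Nr Nt) {n : ℕ}
    (ha : accInfo 𝒳 R Q S h n < R) : ¬ ∃ i, feedback 𝒳 R Q S h n i = ack K := by
  induction n with
  | zero => rintro ⟨i, -⟩; exact i.elim0
  | succ n ih =>
    rintro ⟨i, hi⟩
    rw [feedback_succ] at hi
    revert hi
    refine Fin.lastCases ?_ (fun i => ?_) i
    · rw [Fin.snoc_last, Fin.ext_iff]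
      have := feedbackIndex_val_le (Q := Q) (feedback 𝒳 R Q S h n) ha
      simp only [ack]
      omega
    · rw [Fin.snoc_castSucc]
      exact fun hi => ih ((accInfo_mono h0 h n).trans_lt ha) ⟨i, hi⟩

lemma accInfo_lt_of_feedback_ne_ack (hR : 0 < R) (h : ℕ → RoundGain B Nr Nt) {n : ℕ}
    (hfb : ¬ ∃ i, feedback 𝒳 R Q S h n i = ack K) : accInfo 𝒳 R Q S h n < R := by
  cases n with
  | zero => exact hR
  | succ n =>
    by_contra hn
    push Not at hn
    refine hfb ⟨Fin.last n, ?_⟩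
    rw [feedback_succ, Fin.snoc_last, feedbackIndex, if_pos hn]

/-- By `thr_snoc` the zeroth threshold is the one last found to be reached, and the information
never decreases. -/
lemma thr_zero_le_accInfo (h0 : 0 < 𝒳.card) (hK : 2 ≤ K) (h : ℕ → RoundGain B Nr Nt) {n : ℕ}
    (ha : accInfo 𝒳 R Q S h n < R) :
    Q.thr n (feedback 𝒳 R Q S h n) 0 ≤ accInfo 𝒳 R Q S h n := by
  classical
  induction n with
  | zero => rw [Q.thr_first]; exact le_rfl
  | succ n ih =>
    have hm := accInfo_mono (R := R) (Q := Q) (S := S) h0 h n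
    have h1 := (ih (hm.trans_lt ha)).trans hm
    have h2 := feedbackIndex_val_le (Q := Q) (feedback 𝒳 R Q S h n) ha
    rw [feedback_succ, Q.thr_snoc _ _ _ (by omega), feedbackIndex_val_of_lt _ ha]
    exact Nat.findGreatest_spec (P := fun k => Q.thr n (feedback 𝒳 R Q S h n) k ≤
      accInfo 𝒳 R Q S h (n + 1)) (Nat.zero_le _) h1

lemma accInfo_lt_thr {n : ℕ} (h : ℕ → RoundGain B Nr Nt)
    (ha : accInfo 𝒳 R Q S h (n + 1) < R)
    (hk : (feedbackIndex Q R (feedback 𝒳 R Q S h n) (accInfo 𝒳 R Q S h (n + 1)) : ℕ) < K - 2) :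
    accInfo 𝒳 R Q S h (n + 1) < Q.thr n (feedback 𝒳 R Q S h n)
      (feedbackIndex Q R (feedback 𝒳 R Q S h n) (accInfo 𝒳 R Q S h (n + 1)) + 1) := by
  classical
  rw [feedbackIndex_val_of_lt _ ha] at hk ⊢
  exact not_le.1 (Nat.findGreatest_is_greatest (P := fun k => Q.thr n (feedback 𝒳 R Q S h n) k ≤
    accInfo 𝒳 R Q S h (n + 1)) (Nat.lt_succ_self _) hk)

/-- The event that the feedback after `n` rounds is `fb` and transmission goes on. -/
def activeEvent (𝒳 : Finset ℂ) (B Nr Nt : ℕ) (R : ℝ) (Q : Quantizer K) (S : PowerRule K) {n : ℕ}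
    (fb : Fin n → Fin K) : Set (ℕ → RoundGain B Nr Nt) :=
  {h | feedback 𝒳 R Q S h n = fb ∧ accInfo 𝒳 R Q S h n < R}

lemma measurableSet_activeEvent {n : ℕ} (fb : Fin n → Fin K) :
    MeasurableSet (activeEvent 𝒳 B Nr Nt R Q S fb) :=
  (measurable_feedback n (measurableSet_singleton fb)).inter
    (measurable_accInfo n measurableSet_Iio)

lemma activeEvent_congr {n : ℕ} (fb : Fin n → Fin K) (h h' : ℕ → RoundGain B Nr Nt)
    (hh : ∀ i < n, h i = h' i) (hmem : h ∈ activeEvent 𝒳 B Nr Nt R Q S fb) :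
    h' ∈ activeEvent 𝒳 B Nr Nt R Q S fb := by
  rw [activeEvent, Set.mem_ofPred_eq] at hmem ⊢
  rwa [← feedback_congr hh, ← accInfo_congr hh]

end Dynamics

/-! ### Probabilities for the grid quantizer -/

section Achievability

variable {𝒳 : Finset ℂ} {B Nr Nt K L J : ℕ} [NeZero K] {R M δ C : ℝ} {d : ℕ → ℝ}
  {hd : ∀ n, 0 ≤ d n} {hdu : ∀ n, d n < M / B} {S : PowerRule K}

/-- The feedback certifies about `fbSum` symbols of information, and `J + 1` of them, even lowered
by `d n`, would reach `R`. -/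
lemma fbSum_le_of_accInfo_lt (h0 : 0 < 𝒳.card) (hK : 2 ≤ K) (hδ : 0 ≤ δ) (hd0 : d 0 = δ)
    (hstep : ∀ n < L, d n + δ ≤ d (n + 1)) (hJ : ∀ n, R + d n ≤ (J + 1) * (M / B))
    (h : ℕ → RoundGain B Nr Nt) {n : ℕ} (hn : n ≤ L)
    (ha : accInfo 𝒳 R (gridQuantizer K (M / B) d hd hdu) S h n < R) :
    fbSum (feedback 𝒳 R (gridQuantizer K (M / B) d hd hdu) S h n) ≤ J := by
  have h1 : gridThr K (M / B) d n (feedback 𝒳 R (gridQuantizer K (M / B) d hd hdu) S h n) 0 ≤ _ :=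
    thr_zero_le_accInfo h0 hK h ha
  have h2 := le_gridThr_zero (u := M / B) hd0 hδ hstep hn
    (feedback 𝒳 R (gridQuantizer K (M / B) d hd hdu) S h n)
  have h3 := hJ n
  have hu : 0 < M / B := (hd 0).trans_lt (hdu 0)
  have h4 : (fbSum (feedback 𝒳 R (gridQuantizer K (M / B) d hd hdu) S h n) : ℝ) < J + 1 := by
    refine lt_of_mul_lt_mul_right ?_ hu.le
    linarith
  have h5 : fbSum (feedback 𝒳 R (gridQuantizer K (M / B) d hd hdu) S h n) < J + 1 := by
    exact_mod_cast h4
  omega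

/-- Before the round the information is at least `fbSum fb * u - d n + δ` with `u = M / B`; after
it, less than `(fbSum fb + k + 1) * u - d n`. The difference bounds what the round itself delivered.
-/
lemma activeEvent_snoc_subset (h0 : 0 < 𝒳.card) (hK : 2 ≤ K) (hKJ : J + 2 ≤ K) (hδ : 0 ≤ δ)
    (hd0 : d 0 = δ) (hstep : ∀ n < L, d n + δ ≤ d (n + 1))
    (hJ : ∀ n, R + d n ≤ (J + 1) * (M / B)) {n : ℕ} (hn : n ≤ L) (fb : Fin n → Fin K)
    (k : Fin K) :
    activeEvent 𝒳 B Nr Nt R (gridQuantizer K (M / B) d hd hdu) S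
      (Fin.snoc (α := fun _ => Fin K) fb k : Fin (n + 1) → Fin K) ⊆
    activeEvent 𝒳 B Nr Nt R (gridQuantizer K (M / B) d hd hdu) S fb ∩
      {h | h n ∈ {g | roundInfo 𝒳 (S.power n fb) g < ((k : ℕ) + 1) * (M / B) - δ}} := by
  rintro h ⟨h1, ha⟩
  have hu : 0 < M / B := (hd 0).trans_lt (hdu 0)
  have ha' := (accInfo_mono h0 h n).trans_lt ha
  rw [feedback_succ] at h1
  have hfb : feedback 𝒳 R (gridQuantizer K (M / B) d hd hdu) S h n = fb := by
    have := congrArg (Fin.init (α := fun _ => Fin K)) h1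
    rwa [Fin.init_snoc, Fin.init_snoc] at this
  have hk := congrFun h1 (Fin.last n)
  rw [Fin.snoc_last, Fin.snoc_last] at hk
  refine ⟨⟨hfb, ha'⟩, ?_⟩
  have hlow : gridThr K (M / B) d n (feedback 𝒳 R (gridQuantizer K (M / B) d hd hdu) S h n) 0 ≤ _ :=
    thr_zero_le_accInfo h0 hK h ha'
  have hlow2 := le_gridThr_zero (u := M / B) hd0 hδ hstep hn fb
  have hacc := accInfo_succ (𝒳 := 𝒳) (R := R) (Q := gridQuantizer K (M / B) d hd hdu) (S := S) h n
  rw [hfb] at hlow hacc hk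
  have hup : accInfo 𝒳 R (gridQuantizer K (M / B) d hd hdu) S h (n + 1) <
      (fbSum fb + (k : ℕ) + 1) * (M / B) - d n := by
    by_cases hk2 : (k : ℕ) < K - 2
    · have h2 := accInfo_lt_thr h ha (by rw [hfb, hk]; exact hk2)
      rw [hfb, hk] at h2
      have h3 : (gridQuantizer K (M / B) d hd hdu).thr n fb ((k : ℕ) + 1) = _ :=
        gridThr_of_ne_zero (u := M / B) (d := d) fb (Nat.succ_ne_zero (k : ℕ))
      rw [h3] at h2
      push_cast at h2
      linarith
    -- The top index has no upper threshold. Since `J ≤ K - 2 ≤ k`, the bound `R` takes its place.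
    · have h3 : (J : ℝ) ≤ fbSum fb + (k : ℕ) := by
        have : J ≤ fbSum fb + (k : ℕ) := by omega
        exact_mod_cast this
      have h4 := hJ n
      nlinarith
  change roundInfo 𝒳 (S.power n fb) (h n) < _
  linarith

/-- The same comparison with `R` as the upper limit: after `fbSum fb` symbols, the last round may
bring only the remaining `J - fbSum fb`. -/
lemma outage_subset (h0 : 0 < 𝒳.card) (hK : 2 ≤ K) (hδ : 0 ≤ δ)
    (hd0 : d 0 = δ) (hstep : ∀ n < L, d n + δ ≤ d (n + 1))
    (hJ : ∀ n, R + d n ≤ (J + 1) * (M / B)) {n : ℕ} (hn : n ≤ L) :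
    {h | accInfo 𝒳 (B := B) (Nr := Nr) (Nt := Nt) R (gridQuantizer K (M / B) d hd hdu) S h
      (n + 1) < R} ⊆
    ⋃ fb : Fin n → Fin K, activeEvent 𝒳 B Nr Nt R (gridQuantizer K (M / B) d hd hdu) S fb ∩
      {h | h n ∈ {g | roundInfo 𝒳 (S.power n fb) g <
        ((J - fbSum fb : ℕ) + 1) * (M / B) - δ}} := by
  intro h ha
  rw [Set.mem_ofPred_eq] at ha
  have ha' := (accInfo_mono h0 h n).trans_lt ha
  rw [Set.mem_iUnion]
  refine ⟨feedback 𝒳 R (gridQuantizer K (M / B) d hd hdu) S h n, ⟨rfl, ha'⟩, ?_⟩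
  have hlow : gridThr K (M / B) d n (feedback 𝒳 R (gridQuantizer K (M / B) d hd hdu) S h n) 0 ≤ _ :=
    thr_zero_le_accInfo h0 hK h ha'
  have hlow2 := le_gridThr_zero (u := M / B) hd0 hδ hstep hn
    (feedback 𝒳 R (gridQuantizer K (M / B) d hd hdu) S h n)
  have hsum := fbSum_le_of_accInfo_lt h0 hK hδ hd0 hstep hJ h hn ha'
  have h4 := hJ n
  rw [accInfo_succ] at ha
  change roundInfo 𝒳 (S.power n _) (h n) < _
  rw [Nat.cast_sub hsum]
  linarith

lemma expPowerRule_power_of_activeEvent {r N : ℕ} (h0 : 0 < 𝒳.card) (hK : 2 ≤ K) {x : ℝ}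
    (hx : 0 < x) {Q : Quantizer K} {n : ℕ} {fb : Fin n → Fin K}
    (hne : (activeEvent 𝒳 B Nr Nt R Q S fb).Nonempty) :
    (expPowerRule r N K x).power n fb = x ^ fbExp r N fb := by
  obtain ⟨h, rfl, ha⟩ := hne
  have := feedback_ne_ack h0 hK h ha
  simp only [expPowerRule, if_neg this, abs_of_pos hx]

/-- At power `y = x ^ fbExp`, receiving at most `i` symbols costs `y ^ (-Nr (B Nt - i))`. The larger
exponent on the left compensates exactly this factor. -/
lemma inter_roundInfo_le (hC : ∀ p : ℝ, 0 < p → ∀ i : ℕ, (roundLaw B Nr Nt).real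
      {h | roundInfo 𝒳 p h < (i + 1) * (M / B) - δ} ≤ C * (p ^ (Nr * (B * Nt - i)))⁻¹)
    (h0 : 0 < 𝒳.card) (hK : 2 ≤ K) {x : ℝ} (hx : 0 < x) {Q : Quantizer K} {n : ℕ}
    (fb : Fin n → Fin K) (i : ℕ) :
    (fadingLaw B Nr Nt).real
      (activeEvent 𝒳 B Nr Nt R Q (expPowerRule Nr (B * Nt) K x) fb ∩
      {h | h n ∈ {g | roundInfo 𝒳 ((expPowerRule Nr (B * Nt) K x).power n fb) g <
        (i + 1) * (M / B) - δ}}) * x ^ (fbExp Nr (B * Nt) fb * (1 + Nr * (B * Nt - i))) ≤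
    C * ((fadingLaw B Nr Nt).real
      (activeEvent 𝒳 B Nr Nt R Q (expPowerRule Nr (B * Nt) K x) fb) *
        x ^ fbExp Nr (B * Nt) fb) := by
  rcases Set.eq_empty_or_nonempty
    (activeEvent 𝒳 B Nr Nt R Q (expPowerRule Nr (B * Nt) K x) fb) with he | hne
  · simp [he]
  · have hT : MeasurableSet {g : RoundGain B Nr Nt |
        roundInfo 𝒳 ((expPowerRule Nr (B * Nt) K x).power n fb) g < (i + 1) * (M / B) - δ} :=
      measurable_roundInfo 𝒳 _ measurableSet_Iio
    rw [fadingLaw_inter_eq_mul (measurableSet_activeEvent fb) (activeEvent_congr fb) hT]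
    rw [expPowerRule_power_of_activeEvent h0 hK hx hne]
    have h1 := hC (x ^ fbExp Nr (B * Nt) fb) (by positivity) i
    set q := (roundLaw B Nr Nt).real
      {h | roundInfo 𝒳 (x ^ fbExp Nr (B * Nt) fb) h < (i + 1) * (M / B) - δ}
    set m := (fadingLaw B Nr Nt).real
      (activeEvent 𝒳 B Nr Nt R Q (expPowerRule Nr (B * Nt) K x) fb)
    have hm : 0 ≤ m := measureReal_nonneg
    set y := x ^ fbExp Nr (B * Nt) fb with hy
    have hy0 : 0 < y := by positivity
    calc m * q * x ^ (fbExp Nr (B * Nt) fb * (1 + Nr * (B * Nt - i)))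
        = m * q * (y * y ^ (Nr * (B * Nt - i))) := by
          rw [pow_mul, ← hy, pow_add, pow_one]
      _ ≤ m * (C * (y ^ (Nr * (B * Nt - i)))⁻¹) * (y * y ^ (Nr * (B * Nt - i))) := by gcongr
      _ = C * (m * y) := by field_simp

/-- The balance behind the power rule: probability times power stays `O(x)` along every feedback
path, because each new factor of `fbExp` matches the probability of the index just fed back. -/
lemma activeEvent_mul_pow_le (hC : ∀ p : ℝ, 0 < p → ∀ i : ℕ, (roundLaw B Nr Nt).real
      {h | roundInfo 𝒳 p h < (i + 1) * (M / B) - δ} ≤ C * (p ^ (Nr * (B * Nt - i)))⁻¹)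
    (hC0 : 0 ≤ C) (h0 : 0 < 𝒳.card) (hK : 2 ≤ K) (hKJ : J + 2 ≤ K) (hδ : 0 ≤ δ)
    (hd0 : d 0 = δ) (hstep : ∀ n < L, d n + δ ≤ d (n + 1))
    (hJ : ∀ n, R + d n ≤ (J + 1) * (M / B)) {x : ℝ} (hx : 0 < x) {n : ℕ} (hn : n ≤ L)
    (fb : Fin n → Fin K) :
    (fadingLaw B Nr Nt).real (activeEvent 𝒳 B Nr Nt R (gridQuantizer K (M / B) d hd hdu)
      (expPowerRule Nr (B * Nt) K x) fb) * x ^ fbExp Nr (B * Nt) fb ≤ C ^ n * x := by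
  induction n with
  | zero =>
    simp only [fbExp, Finset.univ_eq_empty, Finset.prod_empty, pow_one, pow_zero]
    gcongr
    exact measureReal_le_one
  | succ n ih =>
    obtain ⟨fb, k, rfl⟩ : ∃ (fb' : Fin n → Fin K) (k : Fin K),
        fb = Fin.snoc (α := fun _ => Fin K) fb' k :=
      ⟨Fin.init fb, fb (Fin.last n), (Fin.snoc_init_self fb).symm⟩
    rw [fbExp_snoc]
    calc _ ≤ _ := by
          refine mul_le_mul_of_nonneg_right (measureReal_mono (activeEvent_snoc_subset h0 hK hKJ hδ
            hd0 hstep hJ (by omega) fb k)) (by positivity)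
      _ ≤ _ := inter_roundInfo_le hC h0 hK hx fb k
      _ ≤ C * (C ^ n * x) := mul_le_mul_of_nonneg_left (ih (by omega) fb) hC0
      _ = _ := by rw [pow_succ]; ring

lemma averagePower_grid_le (hC : ∀ p : ℝ, 0 < p → ∀ i : ℕ, (roundLaw B Nr Nt).real
      {h | roundInfo 𝒳 p h < (i + 1) * (M / B) - δ} ≤ C * (p ^ (Nr * (B * Nt - i)))⁻¹)
    (hC0 : 0 ≤ C) (h0 : 0 < 𝒳.card) (hR : 0 < R) (hK : 2 ≤ K) (hKJ : J + 2 ≤ K) (hδ : 0 ≤ δ)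
    (hd0 : d 0 = δ) (hstep : ∀ n < L, d n + δ ≤ d (n + 1))
    (hJ : ∀ n, R + d n ≤ (J + 1) * (M / B)) {x : ℝ} (hx : 0 < x) :
    averagePower 𝒳 B Nr Nt R (gridQuantizer K (M / B) d hd hdu)
      (expPowerRule Nr (B * Nt) K x) L ≤ (∑ n ∈ Finset.range L, (K : ℝ) ^ n * C ^ n) * x := by
  unfold averagePower
  rw [Finset.sum_mul]
  refine Finset.sum_le_sum fun n hn => ?_
  have hterm : ∀ fb : Fin n → Fin K, feedbackProb 𝒳 B Nr Nt R (gridQuantizer K (M / B) d hd hdu)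
      (expPowerRule Nr (B * Nt) K x) fb * (expPowerRule Nr (B * Nt) K x).power n fb ≤
      C ^ n * x := by
    intro fb
    by_cases hfb : ∃ i, fb i = ack K
    · rw [PowerRule.power_ack _ _ _ hfb, mul_zero]
      positivity
    · have hp : (expPowerRule Nr (B * Nt) K x).power n fb = x ^ fbExp Nr (B * Nt) fb := by
        simp only [expPowerRule, if_neg hfb, abs_of_pos hx]
      rw [hp]
      refine le_trans ?_ (activeEvent_mul_pow_le (hd := hd) (hdu := hdu) hC hC0 h0 hK hKJ hδ hd0
        hstep hJ hx (Finset.mem_range.1 hn).le fb)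
      gcongr
      refine measureReal_mono ?_
      rintro h rfl
      exact ⟨rfl, accInfo_lt_of_feedback_ne_ack hR h hfb⟩
  calc _ ≤ ∑ _fb : Fin n → Fin K, C ^ n * x := Finset.sum_le_sum fun fb _ => hterm fb
    _ = _ := by simp [mul_assoc]

/-- Each feedback vector contributes `O(x)` times an inverse power of `x` whose exponent is bounded
below by `pow_mul_le_fbExp_mul`; there are `K ^ n` vectors. -/
lemma outageProb_grid_le (hC : ∀ p : ℝ, 0 < p → ∀ i : ℕ, (roundLaw B Nr Nt).real
      {h | roundInfo 𝒳 p h < (i + 1) * (M / B) - δ} ≤ C * (p ^ (Nr * (B * Nt - i)))⁻¹)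
    (hC0 : 0 ≤ C) (h0 : 0 < 𝒳.card) (hK : 2 ≤ K) (hKJ : J + 2 ≤ K) (hδ : 0 ≤ δ)
    (hd0 : d 0 = δ) (hstep : ∀ n < L, d n + δ ≤ d (n + 1))
    (hJ : ∀ n, R + d n ≤ (J + 1) * (M / B)) (hJN : J ≤ B * Nt) {x : ℝ} (hx : 1 ≤ x) {n : ℕ}
    (hn : n ≤ L) :
    outageProb 𝒳 B Nr Nt R (gridQuantizer K (M / B) d hd hdu)
      (expPowerRule Nr (B * Nt) K x) (n + 1) ≤
      (K : ℝ) ^ n * C ^ (n + 1) *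
        (x * (x ^ ((1 + Nr * (B * Nt)) ^ n * (1 + Nr * (B * Nt - J))))⁻¹) := by
  have hx0 : 0 < x := by linarith
  have hterm : ∀ fb : Fin n → Fin K, (fadingLaw B Nr Nt).real
      (activeEvent 𝒳 B Nr Nt R (gridQuantizer K (M / B) d hd hdu)
        (expPowerRule Nr (B * Nt) K x) fb ∩
      {h | h n ∈ {g | roundInfo 𝒳 ((expPowerRule Nr (B * Nt) K x).power n fb) g <
        ((J - fbSum fb : ℕ) + 1) * (M / B) - δ}}) ≤
      C ^ (n + 1) * (x * (x ^ ((1 + Nr * (B * Nt)) ^ n * (1 + Nr * (B * Nt - J))))⁻¹) := by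
    intro fb
    rcases Set.eq_empty_or_nonempty (activeEvent 𝒳 B Nr Nt R (gridQuantizer K (M / B) d hd hdu)
        (expPowerRule Nr (B * Nt) K x) fb) with he | ⟨h, hfb, ha⟩
    · rw [he, Set.empty_inter, measureReal_empty]
      positivity
    · have hsum := fbSum_le_of_accInfo_lt h0 hK hδ hd0 hstep hJ h hn ha
      rw [hfb] at hsum
      have h1 := inter_roundInfo_le (R := R) (Q := gridQuantizer K (M / B) d hd hdu) hC h0 hK hx0
        fb (J - fbSum fb)
      have h2 := activeEvent_mul_pow_le (hd := hd) (hdu := hdu) hC hC0 h0 hK hKJ hδ hd0 hstep hJ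
        hx0 hn fb
      have h3 := pow_mul_le_fbExp_mul Nr hJN fb hsum
      rw [← mul_assoc, ← div_eq_mul_inv, le_div_iff₀ (by positivity)]
      refine le_trans (mul_le_mul_of_nonneg_left (pow_le_pow_right₀ hx h3) measureReal_nonneg) ?_
      refine h1.trans ((mul_le_mul_of_nonneg_left h2 hC0).trans (le_of_eq ?_))
      ring
  calc _ ≤ (fadingLaw B Nr Nt).real _ := measureReal_mono (outage_subset h0 hK hδ hd0 hstep hJ hn)
    _ ≤ ∑ fb : Fin n → Fin K, _ := measureReal_iUnion_fintype_le _
    _ ≤ ∑ _fb : Fin n → Fin K,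
        C ^ (n + 1) * (x * (x ^ ((1 + Nr * (B * Nt)) ^ n * (1 + Nr * (B * Nt - J))))⁻¹) :=
        Finset.sum_le_sum fun fb _ => hterm fb
    _ = _ := by simp [mul_assoc]

end Achievability

/-! ## Exponents -/

lemma neg_log_const_mul_div (c : ℝ) (hc : 0 < c) (E : ℕ) {P : ℝ} (hP : 1 < P) :
    -Real.log (c * P * (P ^ E)⁻¹) / Real.log P = ((E : ℝ) - 1) - Real.log c / Real.log P := by
  have hl : 0 < Real.log P := Real.log_pos hP
  have hP0 : 0 < P := by linarith
  rw [Real.log_mul (by positivity) (by positivity), Real.log_mul hc.ne' hP0.ne', Real.log_inv,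
    Real.log_pow]
  field_simp
  ring

lemma tendsto_exponent_of_bounds {c C : ℝ} (hc : 0 < c) (hC : 0 < C) (E : ℕ) {f : ℝ → ℝ}
    (hlow : ∀ᶠ P in atTop, c * P * (P ^ E)⁻¹ ≤ f P)
    (hup : ∀ᶠ P in atTop, f P ≤ C * P * (P ^ E)⁻¹) :
    Tendsto (fun P => -Real.log (f P) / Real.log P) atTop (𝓝 ((E : ℝ) - 1)) := by
  have hlim : ∀ a : ℝ, Tendsto (fun P => ((E : ℝ) - 1) - Real.log a / Real.log P) atTop
      (𝓝 ((E : ℝ) - 1)) := by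
    intro a
    have := (tendsto_const_nhds (x := (E : ℝ) - 1)).sub
      (Tendsto.const_div_atTop Real.tendsto_log_atTop (Real.log a))
    rwa [sub_zero] at this
  refine tendsto_of_tendsto_of_tendsto_of_le_of_le' (hlim C) (hlim c) ?_ ?_
  · filter_upwards [hlow, hup, eventually_gt_atTop 1] with P h1 h2 hP
    have hP0 : 0 < P := by linarith
    rw [← neg_log_const_mul_div C hC E hP]
    have hl : 0 < Real.log P := Real.log_pos hP
    have hf : 0 < f P := lt_of_lt_of_le (by positivity) h1
    gcongr
  · filter_upwards [hlow, eventually_gt_atTop 1] with P h1 hP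
    have hP0 : 0 < P := by linarith
    rw [← neg_log_const_mul_div c hc E hP]
    have hl : 0 < Real.log P := Real.log_pos hP
    gcongr

/-- As `B R / M` lies strictly between `J` and `J + 1`, the floor in the Singleton exponent is `B Nt
- J - 1`, so `d† + 1 = 1 + Nr (B Nt - J)`. -/
lemma arqDiversity_eq {B Nr Nt J : ℕ} {M R : ℝ} (hJN : J ≤ B * Nt) (hJ1 : (J : ℝ) < B * R / M)
    (hJ2 : B * R / M < J + 1) (n : ℕ) : arqDiversity B Nr Nt M R (n + 1) =
      (((1 + Nr * (B * Nt)) ^ n * (1 + Nr * (B * Nt - J)) : ℕ) : ℝ) - 1 := by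
  have hfloor : ⌊(B : ℝ) * (Nt - R / M)⌋ = (B * Nt : ℤ) - J - 1 := by
    rw [Int.floor_eq_iff]
    have : (B : ℝ) * (Nt - R / M) = B * Nt - B * R / M := by ring
    rw [this]
    push_cast
    constructor <;> linarith
  unfold arqDiversity singletonDiversity
  rw [hfloor]
  push_cast [Nat.cast_sub hJN]
  ring

end INRARQ

end

/-! ### Choice of the constants and conclusion -/

theorem theorem2
    -- numbers of blocks, receive and transmit antennas, rounds, feedback levels
    (B Nr Nt L K : ℕ) (hB : 0 < B) (hNr : 0 < Nr) (hNt : 0 < Nt) [NeZero K]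
    -- the constellation: size `2 ^ M`, unit average energy
    (𝒳 : Finset ℂ) (M : ℝ) (hM : (𝒳.card : ℝ) = (2 : ℝ) ^ M)
    (henergy : (𝒳.card : ℝ)⁻¹ * ∑ x ∈ 𝒳, ‖x‖ ^ 2 = 1)
    -- the rate
    (R : ℝ) (hR : 0 < R) (hRM : R < M * Nt)
    (hint : ∀ z : ℤ, (B : ℝ) * R / M ≠ z)
    (hK : ⌈(B : ℝ) * R / M⌉₊ + 1 ≤ K) :
    -- optimality: the exponent of the least outage probability at each round
    (∀ l : ℕ, 1 ≤ l → l ≤ L →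
      Tendsto
        (fun P : ℝ => -Real.log (INRARQ.optimalOutageProb 𝒳 B Nr Nt K R L l P) / Real.log P)
        atTop (𝓝 (INRARQ.arqDiversity B Nr Nt M R l))) ∧
    -- achievability: one choice of thresholds and power rules attains it at all rounds
    (∃ (Q : INRARQ.Quantizer K) (S : ℝ → INRARQ.PowerRule K),
      (∀ P : ℝ, 0 < P → INRARQ.averagePower 𝒳 B Nr Nt R Q (S P) L ≤ P) ∧
      ∀ l : ℕ, 1 ≤ l → l ≤ L →
        Tendsto
          (fun P : ℝ => -Real.log (INRARQ.outageProb 𝒳 B Nr Nt R Q (S P) l) / Real.log P)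
          atTop (𝓝 (INRARQ.arqDiversity B Nr Nt M R l))) := by
  open INRARQ in
  have hB' : (0 : ℝ) < B := by exact_mod_cast hB
  have hNt' : (0 : ℝ) < Nt := by exact_mod_cast hNt
  have hM0 : 0 < M := pos_of_mul_pos_left (hR.trans hRM) hNt'.le
  have h0 : 0 < 𝒳.card := by
    have : (0 : ℝ) < 𝒳.card := by rw [hM]; positivity
    exact_mod_cast this
  set J : ℕ := ⌊(B : ℝ) * R / M⌋₊ with hJdef
  have hx0 : 0 ≤ (B : ℝ) * R / M := by positivity
  have hJ1 : (J : ℝ) < B * R / M :=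
    lt_of_le_of_ne (Nat.floor_le hx0) fun h => hint J (by rw [← h]; simp)
  have hJ2 : (B : ℝ) * R / M < J + 1 := Nat.lt_floor_add_one _
  have hu : 0 < M / B := by positivity
  have hJR : J * (M / B) < R := by
    rw [lt_div_iff₀ hM0] at hJ1
    rw [← mul_div_assoc, div_lt_iff₀ hB']
    linarith
  have hRJ : R < (J + 1) * (M / B) := by
    rw [div_lt_iff₀ hM0] at hJ2
    rw [← mul_div_assoc, lt_div_iff₀ hB']
    linarith
  have hJN : J ≤ B * Nt := by
    have h1 : (B : ℝ) * R / M < B * Nt := by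
      rw [div_lt_iff₀ hM0]
      nlinarith
    have : (J : ℝ) < (B * Nt : ℕ) := by
      push_cast
      exact hJ1.trans h1
    exact_mod_cast this.le
  have hKJ : J + 2 ≤ K := by
    have : J < ⌈(B : ℝ) * R / M⌉₊ := Nat.lt_ceil.2 hJ1
    omega
  have hK2 : 2 ≤ K := by omega
  -- The room between `R` and the next grid point, positive because `B R / M < J + 1`; it is shared
  -- among the rounds in `L + 1` steps of size `δ`.
  set γ : ℝ := (J + 1) * (M / B) - R with hγ
  have hγ0 : 0 < γ := by linarith
  set δ : ℝ := γ / (L + 1) with hδdef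
  have hδ : 0 < δ := by positivity
  have hδL : δ * (L + 1) = γ := by rw [hδdef]; field_simp
  -- The minimum with `L` keeps `d` at most `γ` for all `n`, since the quantizer has thresholds in
  -- every round.
  let d : ℕ → ℝ := fun n => δ * ((min n L : ℕ) + 1)
  have hdγ : ∀ n, d n ≤ γ := by
    intro n
    rw [← hδL]
    have : ((min n L : ℕ) : ℝ) ≤ L := by exact_mod_cast min_le_right n L
    simp only [d]
    gcongr
  have hd : ∀ n, 0 ≤ d n := fun n => by positivity
  have hdu : ∀ n, d n < M / B := fun n => (hdγ n).trans_lt (by rw [hγ]; linarith)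
  have hd0 : d 0 = δ := by simp [d]
  have hstep : ∀ n < L, d n + δ ≤ d (n + 1) := by
    intro n hn
    simp only [d, min_eq_left hn.le, min_eq_left (Nat.succ_le_of_lt hn)]
    push_cast
    linarith
  have hdJ : ∀ n, R + d n ≤ (J + 1) * (M / B) := fun n => by
    have := hdγ n
    linarith
  obtain ⟨C, hC1, hC⟩ := exists_roundLaw_roundInfo_lt_le (Nr := Nr) hB hNt hM hM0 hδ
  have hC0 : 0 < C := by linarith
  have hKpos : (0 : ℝ) < K := by exact_mod_cast NeZero.pos K
  set σ : ℝ := ∑ n ∈ Finset.range L, (K : ℝ) ^ n * C ^ n with hσ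
  have hσ0 : 0 ≤ σ := Finset.sum_nonneg fun n _ => by positivity
  -- Rescaling `P` by `a` absorbs the constant `σ` of the power bound; the added `1` covers `σ = 0`.
  set a : ℝ := (σ + 1)⁻¹ with ha
  have ha0 : 0 < a := by positivity
  let Q : Quantizer K := gridQuantizer K (M / B) d hd hdu
  let S : ℝ → PowerRule K := fun P => expPowerRule Nr (B * Nt) K (a * P)
  have hav : ∀ P : ℝ, 0 < P → averagePower 𝒳 B Nr Nt R Q (S P) L ≤ P := by
    intro P hP
    refine (averagePower_grid_le (J := J) hC hC0.le h0 hR hK2 hKJ hδ.le hd0 hstep hdJ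
      (mul_pos ha0 hP)).trans ?_
    rw [← hσ, ← mul_assoc]
    refine mul_le_of_le_one_left hP.le ?_
    rw [ha, ← div_eq_mul_inv, div_le_one (by positivity)]
    linarith
  have hup : ∀ n < L, ∀ P : ℝ, a⁻¹ ≤ P → outageProb 𝒳 B Nr Nt R Q (S P) (n + 1) ≤
      (K : ℝ) ^ n * C ^ (n + 1) * a *
        (a ^ ((1 + Nr * (B * Nt)) ^ n * (1 + Nr * (B * Nt - J))))⁻¹ * P *
        (P ^ ((1 + Nr * (B * Nt)) ^ n * (1 + Nr * (B * Nt - J))))⁻¹ := by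
    intro n hn P hP
    have h1 : 1 ≤ a * P := by
      rwa [← inv_le_iff_one_le_mul₀' ha0]
    refine (outageProb_grid_le hC hC0.le h0 hK2 hKJ hδ.le hd0 hstep hdJ hJN h1 hn.le).trans
      (le_of_eq ?_)
    rw [mul_pow, mul_inv]
    ring
  have hlow := fun n => exists_le_outageProb (𝒳 := 𝒳) (Nr := Nr) hB hNt hM R K hJN hJR n
  refine ⟨fun l hl1 hlL => ?_, Q, S, hav, fun l hl1 hlL => ?_⟩
  all_goals
    obtain ⟨n, rfl⟩ : ∃ n, l = n + 1 := ⟨l - 1, by omega⟩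
    obtain ⟨c, hc, hlow⟩ := hlow n
    rw [arqDiversity_eq hJN hJ1 hJ2 n]
  · have hbdd : ∀ P, BddBelow {p : ℝ | ∃ (Q : Quantizer K) (S : PowerRule K),
        averagePower 𝒳 B Nr Nt R Q S L ≤ P ∧ p = outageProb 𝒳 B Nr Nt R Q S (n + 1)} := by
      rintro P
      refine ⟨0, ?_⟩
      rintro p ⟨Q, S, -, rfl⟩
      exact measureReal_nonneg
    refine tendsto_exponent_of_bounds hc (C := (K : ℝ) ^ n * C ^ (n + 1) * a *
      (a ^ ((1 + Nr * (B * Nt)) ^ n * (1 + Nr * (B * Nt - J))))⁻¹) (by positivity) _ ?_ ?_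
    · filter_upwards [eventually_ge_atTop 1] with P hP
      refine le_csInf ⟨_, Q, S P, hav P (by linarith), rfl⟩ ?_
      rintro p ⟨Q', S', hav', rfl⟩
      exact hlow L P Q' S' (by omega) hP hav'
    · filter_upwards [eventually_ge_atTop a⁻¹, eventually_gt_atTop 0] with P hP hP0
      exact (csInf_le (hbdd P) ⟨Q, S P, hav P hP0, rfl⟩).trans (hup n (by omega) P hP)
  · refine tendsto_exponent_of_bounds hc (C := (K : ℝ) ^ n * C ^ (n + 1) * a *
      (a ^ ((1 + Nr * (B * Nt)) ^ n * (1 + Nr * (B * Nt - J))))⁻¹) (by positivity) _ ?_ ?_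
    · filter_upwards [eventually_ge_atTop 1] with P hP
      exact hlow L P Q (S P) (by omega) hP (hav P (by linarith))
    · filter_upwards [eventually_ge_atTop a⁻¹] with P hP
      exact hup n (by omega) P hP
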